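/- Let $\Bbbk$ be a commutative ring. All operads are symmetric operads of $\Bbbk$-modules, with right actions $*$ of the symmetric groups $\mathbb S_n$, identity $\mathbf 1\in\mathcal P(1)$ and partial compositions $\circ_i$. An endomorphism of an operad $\mathcal P$ is a family of $\Bbbk$-linear maps $\mathcal P(n)\to\mathcal P(n)$, $n\ge 0$, preserving $\mathbf 1$, the $\mathbb S_n$-actions and the maps $\circ_i$; $\mathrm{End}(\mathcal P)$ is the monoid of endomorphisms and $\mathrm{Aut}(\mathcal P)$ the group of invertible ones. $\mathrm{IAut}(\mathcal P)$ is the normal subgroup of inner automorphisms $\theta\mapsto(\lambda^{-1}\circ\theta)\circ(\lambda,\dots,\lambda)$, for invertible $\lambda\in\mathcal P(1)$, and $\mathrm{OAut}(\mathcal P)=\mathrm{Aut}(\mathcal P)/\mathrm{IAut}(\mathcal P)$. For $c\in\Bbbk^\times$ let $\mathrm{s}_c\in\mathrm{Aut}(\mathcal P)$ be $\theta\mapsto c^{\,n-1}\theta$ for $\theta\in\mathcal P(n)$. If $\mathcal P(0)$ is spanned by an element $\mathbf 1_0$, the $K$-th truncation ideal ${}^K\mathcal I$ ($K\geq 1$)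 is defined by ${}^K\mathcal I(n)=0$ for $n<K$, and for $n\ge K$ by ${}^K\mathcal I(n)=\bigcap_{|I|=K-1}\ker\pi^I$, where for $I\subseteq\{1,\dots,n\}$ with characteristic function $\chi_I$ the operator $\pi^I:\mathcal P(n)\to\mathcal P(|I|)$ is $\theta\mapsto\theta\circ(\mathbf 1_{\chi_I(1)},\dots,\mathbf 1_{\chi_I(n)})$, with $\mathbf 1_1=\mathbf 1$. Let $\mathrm{As}$ be the operad of unital associative algebras, $\mathrm{As}(n)=\Bbbk\mathbb S_n$. Let $\mathrm{Lie}$ be the operad generated by $b\in\mathrm{Lie}(2)$ subject to $b*(12)=-b$ and $b\circ_2 b=b\circ_1 b+(b\circ_2 b)*(12)$. Let $\mathrm{Pois}$ be the operad of unital commutative Poisson algebras, generated by $\mathbf 1_0$ (arity $0$) and $\mathbf 1_2,b$ (arity $2$) subject to $\mathbf 1_2\circ_1\mathbf 1_0=\mathbf 1_2\circ_2\mathbf 1_0=\mathbf 1$, $b\circ_1\mathbf 1_0=b\circ_2\mathbf 1_0=0$, $\mathbf 1_2*(12)=\mathbf 1_2$, $b*(12)=-b$, $\mathbf 1_2\circ_1\mathbf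 1_2=\mathbf 1_2\circ_2\mathbf 1_2$, $b\circ_1\mathbf 1_2=\mathbf 1_2\circ_2 b+(\mathbf 1_2\circ_2 b)*(12)$ and $b\circ_2 b=b\circ_1 b+(b\circ_2 b)*(12)$. Then: 1. Suppose that $\Bbbk\ne 0$ has no idempotents other than $0$ and $1$, and let $\mathcal P=\mathrm{As}$ or $\mathcal P=\mathrm{As}/{}^K\mathcal I$ with $K\ge 4$. Then $c\mapsto \mathrm s_c$ is an isomorphism $\Bbbk^\times\cong\mathrm{IAut}(\mathcal P)$; it extends to an isomorphism $\Bbbk^\times\rtimes\mathbb Z_2\cong\mathrm{Aut}(\mathcal P)$ (for the trivial action of $\mathbb Z_2$ on $\Bbbk^\times$); $\mathrm{OAut}(\mathcal P)\cong\mathbb Z_2$; and $\mathrm{End}(\mathcal P)=\mathrm{Aut}(\mathcal P)$. 2. For $\mathcal P=\mathrm{Lie}$ (and arbitrary $\Bbbk$), $c\mapsto \mathrm s_c$ is an isomorphism $\Bbbk^\times\cong\mathrm{IAut}(\mathcal P)$; $\mathrm{Aut}(\mathcal P)=\mathrm{IAut}(\mathcal P)$, so that $\mathrm{OAut}(\mathcal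 P)=\{1\}$; and there is an isomorphism of $\mathrm{End}(\mathcal P)$ with the multiplicative monoid of $\Bbbk$ under which $\mathrm s_c$ corresponds to $c$. 3. Suppose that $0$ is the only $e\in\Bbbk$ with $2e=0$ and $e^2=0$ (for example, $\Bbbk$ is a field, or $2$ is not a zero divisor in $\Bbbk$), and let $\mathcal P=\mathrm{Pois}$ or $\mathcal P=\mathrm{Pois}/{}^K\mathcal I$ with $K\ge 3$; if $\mathcal P=\mathrm{Pois}/{}^3\mathcal I$, suppose moreover that $2e=0$ implies $e=0$ for all $e\in\Bbbk$. Then $c\mapsto \mathrm s_c$ is an isomorphism $\Bbbk^\times\cong\mathrm{IAut}(\mathcal P)$; there is a group isomorphism $\mathrm{Aut}(\mathcal P)\cong\Bbbk^\times\times\Bbbk^\times$ under which $\mathrm s_c$ corresponds to $(c,c)$; $\mathrm{OAut}(\mathcal P)\cong\Bbbk^\times$; and there is an isomorphism of $\mathrm{End}(\mathcal P)$ with the multiplicative monoid $\Bbbk\times\Bbbk^\times$ under which $\mathrm s_c$ corresponds to $(c,c)$. -/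

import Mathlib

universe u v

/-! ## Partial composition of permutations -/

/-- The inputs of `μ ∘ᵢ ν`, for `μ` of arity `m` and `ν` of arity `n`, are the inputs `j ≠ i` of `μ`
and the inputs of `ν`. This bijection gives the position (counted from `0`) of each of them:
`j < i` stays, `j > i` moves to `j + n - 1`, and the input `t` of `ν` moves to `i + t`.
The total arity `r = m + n - 1` is encoded by `r + 1 = m + n`. -/
def insEquiv {m n r : ℕ} (h : r + 1 = m + n) (i : Fin m) :
    {j : Fin m // j ≠ i} ⊕ Fin n ≃ Fin r where
  toFun
    | Sum.inl j =>
        if hj : j.1.1 < i.1 then ⟨j.1.1, by have := i.2; omega⟩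
        else ⟨j.1.1 + n - 1, by
          have h1 := j.1.2
          have h2 : j.1.1 ≠ i.1 := fun e => j.2 (Fin.ext e)
          omega⟩
    | Sum.inr t => ⟨i.1 + t.1, by have := t.2; have := i.2; omega⟩
  invFun p :=
    if h1 : p.1 < i.1 then
      Sum.inl ⟨⟨p.1, by have := i.2; omega⟩, fun e => by have := congrArg Fin.val e; simp at this; omega⟩
    else if h2 : p.1 < i.1 + n then Sum.inr ⟨p.1 - i.1, by omega⟩
    else Sum.inl ⟨⟨p.1 + 1 - n, by have := p.2; omega⟩,
      fun e => by have := congrArg Fin.val e; simp at this; omega⟩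
  left_inv := by
    rintro (⟨j, hj⟩ | t)
    · have h2 : j.1 ≠ i.1 := fun e => hj (Fin.ext e)
      have h3 := i.2
      by_cases h1 : j.1 < i.1
      · simp [h1]
      · have h4 : ¬ (j.1 + n - 1 < i.1) := by omega
        have h5 : ¬ (j.1 + n - 1 < i.1 + n) := by omega
        simp only [h1, dite_false, h4, h5]
        congr 2
        apply Fin.ext
        simp only
        omega
    · have h1 : ¬ (i.1 + t.1 < i.1) := by omega
      simp [h1]
  right_inv := by
    intro p
    by_cases h1 : p.1 < i.1
    · simp [h1]
    · by_cases h2 : p.1 < i.1 + n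
      · simp only [h1, dite_false, h2, dite_true]
        apply Fin.ext
        simp only
        omega
      · have h3 : ¬ (p.1 + 1 - n < i.1) := by omega
        simp only [h1, dite_false, h2, h3]
        apply Fin.ext
        simp only
        omega

/-- The partial composition `φ ∘ᵢ σ` of permutations, `φ` of `m` letters and `σ` of `n` letters:
the block permutation sending the input `j ≠ i` of `φ` to the input `φ j`, and the input `t` of the
inserted block to the input `σ t` of the block inserted at `φ i`. -/
def permComp {m n r : ℕ} (h : r + 1 = m + n) (φ : Equiv.Perm (Fin m)) (i : Fin m)
    (σ : Equiv.Perm (Fin n)) : Equiv.Perm (Fin r) :=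
  (insEquiv h i).symm.trans
    ((Equiv.sumCongr
      (φ.subtypeEquiv (fun j => by simp : ∀ j, j ≠ i ↔ φ j ≠ φ i)) σ).trans
      (insEquiv h (φ i)))

theorem permComp_inl {m n r : ℕ} (h : r + 1 = m + n) (φ : Equiv.Perm (Fin m)) (i : Fin m)
    (σ : Equiv.Perm (Fin n)) (p : Fin r) (j : Fin m) (hj : j ≠ i)
    (hp : p.1 = if j.1 < i.1 then j.1 else j.1 + n - 1) :
    (permComp h φ i σ p).1 = if (φ j).1 < (φ i).1 then (φ j).1 else (φ j).1 + n - 1 := by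
  have e : p = insEquiv h i (Sum.inl ⟨j, hj⟩) := by
    apply Fin.ext
    rw [hp]
    simp only [insEquiv, Equiv.coe_fn_mk]
    split_ifs <;> rfl
  subst e
  simp only [permComp, Equiv.trans_apply, Equiv.symm_apply_apply, Equiv.sumCongr_apply, Sum.map_inl,
    Equiv.subtypeEquiv_apply]
  simp only [insEquiv, Equiv.coe_fn_mk]
  split_ifs <;> rfl

theorem permComp_inr {m n r : ℕ} (h : r + 1 = m + n) (φ : Equiv.Perm (Fin m)) (i : Fin m)
    (σ : Equiv.Perm (Fin n)) (p : Fin r) (t : Fin n) (hp : p.1 = i.1 + t.1) :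
    (permComp h φ i σ p).1 = (φ i).1 + (σ t).1 := by
  have e : p = insEquiv h i (Sum.inr t) := Fin.ext hp
  subst e
  simp only [permComp, Equiv.trans_apply, Equiv.symm_apply_apply, Equiv.sumCongr_apply, Sum.map_inr]
  rfl

theorem ins_cases {m n r : ℕ} (h : r + 1 = m + n) (i : Fin m) (p : Fin r) :
    (∃ j : Fin m, j ≠ i ∧ p.1 = if j.1 < i.1 then j.1 else j.1 + n - 1) ∨
      ∃ t : Fin n, p.1 = i.1 + t.1 := by
  obtain ⟨x, rfl⟩ := (insEquiv h i).surjective p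
  rcases x with ⟨j, hj⟩ | t
  · refine Or.inl ⟨j, hj, ?_⟩
    simp only [insEquiv, Equiv.coe_fn_mk]
    split_ifs <;> rfl
  · exact Or.inr ⟨t, rfl⟩

theorem permComp_mul {m n r : ℕ} (h : r + 1 = m + n) (φ ψ : Equiv.Perm (Fin m)) (i : Fin m)
    (σ τ : Equiv.Perm (Fin n)) :
    permComp h (φ * ψ) i (σ * τ) = permComp h φ (ψ i) σ * permComp h ψ i τ := by
  ext p
  rcases ins_cases h i p with ⟨j, hj, hp⟩ | ⟨t, hp⟩
  · exact (permComp_inl h (φ * ψ) i (σ * τ) p j hj hp).trans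
      (permComp_inl h φ (ψ i) σ _ (ψ j) (by simpa using hj) (permComp_inl h ψ i τ p j hj hp)).symm
  · exact (permComp_inr h (φ * ψ) i (σ * τ) p t hp).trans
      (permComp_inr h φ (ψ i) σ _ (τ t) (permComp_inr h ψ i τ p t hp)).symm

theorem permComp_one_right {n : ℕ} (h : n + 1 = n + 1) (φ : Equiv.Perm (Fin n)) (i : Fin n) :
    permComp h φ i (1 : Equiv.Perm (Fin 1)) = φ := by
  ext p
  rcases ins_cases h i p with ⟨j, hj, hp⟩ | ⟨t, hp⟩
  · have e : p = j := Fin.ext (by rw [hp]; split_ifs <;> rfl)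
    rw [permComp_inl h _ i _ p j hj hp, e]
    split_ifs <;> simp
  · have e : p = i := Fin.ext (by have := t.2; omega)
    rw [permComp_inr h _ i _ p t hp, e]
    simp

theorem permComp_one_left {n : ℕ} (h : n + 1 = 1 + n) (σ : Equiv.Perm (Fin n)) :
    permComp h (1 : Equiv.Perm (Fin 1)) 0 σ = σ := by
  ext p
  rcases ins_cases h 0 p with ⟨j, hj, hp⟩ | ⟨t, hp⟩
  · exact absurd (Subsingleton.elim j 0) hj
  · have e : p = t := Fin.ext (by simpa using hp)
    rw [permComp_inr h _ 0 _ p t hp, e]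
    simp

theorem permComp_assoc {l m n a b s : ℕ} (h₁ : a + 1 = l + m) (h₂ : s + 1 = a + n)
    (h₃ : b + 1 = m + n) (h₄ : s + 1 = l + b) (i : Fin l) (j : Fin m) (q : Fin a)
    (hq : q.1 = i.1 + j.1) (α : Equiv.Perm (Fin l)) (β : Equiv.Perm (Fin m))
    (γ : Equiv.Perm (Fin n)) :
    permComp h₂ (permComp h₁ α i β) q γ = permComp h₄ α i (permComp h₃ β j γ) := by
  have hαq : (permComp h₁ α i β q).1 = (α i).1 + (β j).1 := permComp_inr h₁ α i β q j hq
  ext p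
  rcases ins_cases h₄ i p with ⟨x, hx, hp⟩ | ⟨y, hp⟩
  · rw [permComp_inl h₄ α i _ p x hx hp]
    have hx' : x.1 ≠ i.1 := fun e => hx (Fin.ext e)
    have hαx : (α x).1 ≠ (α i).1 := fun e => hx (α.injective (Fin.ext e))
    have hj := j.2
    have hβj := (β j).2
    have hxl := x.2
    have hil := i.2
    obtain ⟨z, hz⟩ : ∃ z : Fin a, z.1 = if x.1 < i.1 then x.1 else x.1 + m - 1 :=
      ⟨⟨if x.1 < i.1 then x.1 else x.1 + m - 1, by split_ifs <;> omega⟩, rfl⟩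
    have hzq : z ≠ q := fun e => by
      have := congrArg Fin.val e
      split_ifs at hz <;> omega
    rw [permComp_inl h₂ _ q γ p z hzq (by split_ifs at * <;> omega), hαq,
      permComp_inl h₁ α i β z x hx hz]
    split_ifs <;> omega
  · rw [permComp_inr h₄ α i _ p y hp]
    rcases ins_cases h₃ j y with ⟨x, hx, hy⟩ | ⟨t, hy⟩
    · rw [permComp_inl h₃ β j γ y x hx hy]
      have hx' : x.1 ≠ j.1 := fun e => hx (Fin.ext e)
      have hxl := x.2
      have hil := i.2
      obtain ⟨z, hz⟩ : ∃ z : Fin a, z.1 = i.1 + x.1 := ⟨⟨i.1 + x.1, by omega⟩, rfl⟩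
      have hzq : z ≠ q := fun e => by
        have := congrArg Fin.val e
        omega
      have hβx : (β x).1 ≠ (β j).1 := fun e => hx (β.injective (Fin.ext e))
      rw [permComp_inl h₂ _ q γ p z hzq (by split_ifs at * <;> omega), hαq,
        permComp_inr h₁ α i β z x hz]
      split_ifs <;> omega
    · rw [permComp_inr h₃ β j γ y t hy, permComp_inr h₂ _ q γ p t (by omega), hαq]
      omega

theorem permComp_comm {l m n a b s : ℕ} (h₁ : a + 1 = l + m) (h₂ : s + 1 = a + n)
    (h₃ : b + 1 = l + n) (h₄ : s + 1 = b + m) (i c : Fin l) (hic : i.1 < c.1) (q : Fin a)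
    (hq : q.1 + 1 = c.1 + m) (q' : Fin b) (hq' : q'.1 = i.1) (α : Equiv.Perm (Fin l))
    (β : Equiv.Perm (Fin m)) (γ : Equiv.Perm (Fin n)) :
    permComp h₂ (permComp h₁ α i β) q γ = permComp h₄ (permComp h₃ α c γ) q' β := by
  have hcl := c.2
  have hci : c ≠ i := fun e => by rw [e] at hic; omega
  have hαci : (α c).1 ≠ (α i).1 := fun e => hci (α.injective (Fin.ext e))
  have hα := permComp_inl h₁ α i β q c hci (by rw [if_neg (by omega)]; omega)
  have hα' := permComp_inl h₃ α c γ q' i hci.symm (by split_ifs <;> omega)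
  have := (α c).2
  have := (α i).2
  ext p
  rcases ins_cases h₂ q p with ⟨z, hz, hp⟩ | ⟨t, hp⟩
  · have hz' : z.1 ≠ q.1 := fun e => hz (Fin.ext e)
    rw [permComp_inl h₂ _ q γ p z hz hp, hα]
    rcases ins_cases h₁ i z with ⟨x, hx, hzx⟩ | ⟨t, ht⟩
    · rw [permComp_inl h₁ α i β z x hx hzx]
      have hx' : x.1 ≠ i.1 := fun e => hx (Fin.ext e)
      have hαx : (α x).1 ≠ (α i).1 := fun e => hx (α.injective (Fin.ext e))
      have hxl := x.2
      have hxc : x ≠ c := fun e => by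
        subst e
        split_ifs at hzx <;> omega
      have hxc' : x.1 ≠ c.1 := fun e => hxc (Fin.ext e)
      have hαxc : (α x).1 ≠ (α c).1 := fun e => hxc (α.injective (Fin.ext e))
      have := (α x).2
      obtain ⟨w, hw⟩ : ∃ w : Fin b, w.1 = if x.1 < c.1 then x.1 else x.1 + n - 1 :=
        ⟨⟨if x.1 < c.1 then x.1 else x.1 + n - 1, by split_ifs <;> omega⟩, rfl⟩
      have hwq : w ≠ q' := fun e => by
        have := congrArg Fin.val e
        split_ifs at hw <;> omega
      rw [permComp_inl h₄ _ q' β p w hwq (by clear hα hα'; split_ifs at hp hzx hw ⊢ <;> omega), hα',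
        permComp_inl h₃ α c γ w x hxc hw]
      clear hα hα' hp hzx hw
      split_ifs <;> omega
    · have := t.2
      have := (β t).2
      rw [permComp_inr h₁ α i β z t ht,
        permComp_inr h₄ _ q' β p t (by clear hα hα'; split_ifs at hp <;> omega), hα']
      clear hα hα' hp
      split_ifs <;> omega
  · have := t.2
    have := (γ t).2
    rw [permComp_inr h₂ _ q γ p t hp, hα]
    obtain ⟨w, hw⟩ : ∃ w : Fin b, w.1 = c.1 + t.1 := ⟨⟨c.1 + t.1, by omega⟩, rfl⟩
    have hwq : w ≠ q' := fun e => by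
      have := congrArg Fin.val e
      omega
    rw [permComp_inl h₄ _ q' β p w hwq (by clear hα hα'; split_ifs <;> omega), hα',
      permComp_inr h₃ α c γ w t hw]
    clear hα hα' hp hw
    split_ifs <;> omega

/-! ## Symmetric operads -/

/-- A symmetric operad over a commutative ring `k`, in the partial-composition presentation:
right `k`-linear actions of the symmetric groups on modules `P n`, an identity in `P 1`, and bilinear
partial compositions `∘ᵢ : P m ⊗ P n → P (m + n - 1)`. Inputs are numbered from `0`. To avoid
transports between the modules `P n`, the arity `r` of a composite is a separate variable together
with a proof of `r + 1 = m + n` (`i : Fin m` forces `m ≥ 1`); likewise the positions that occur in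
the associativity axioms are variables pinned down by equations. -/
structure SymOperad (k : Type u) [CommRing k] where
  obj : ℕ → Type v
  [acg : ∀ n, AddCommGroup (obj n)]
  [mod : ∀ n, Module k (obj n)]
  /-- the right action, `act σ θ = θ * σ` -/
  act : ∀ {n : ℕ}, Equiv.Perm (Fin n) → obj n →ₗ[k] obj n
  one : obj 1
  /-- `comp h i μ ν = μ ∘ᵢ ν` -/
  comp : ∀ {m n r : ℕ}, r + 1 = m + n → Fin m → obj m →ₗ[k] obj n →ₗ[k] obj r
  act_one : ∀ {n : ℕ} (θ : obj n), act 1 θ = θ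
  act_mul : ∀ {n : ℕ} (σ τ : Equiv.Perm (Fin n)) (θ : obj n), act (σ * τ) θ = act τ (act σ θ)
  comp_one : ∀ {n : ℕ} (h : n + 1 = n + 1) (i : Fin n) (θ : obj n), comp h i θ one = θ
  one_comp : ∀ {n : ℕ} (h : n + 1 = 1 + n) (θ : obj n), comp h 0 one θ = θ
  /-- `(α ∘ᵢ β) ∘_{i+j} γ = α ∘ᵢ (β ∘ⱼ γ)` -/
  assoc : ∀ {l m n a b s : ℕ} (h₁ : a + 1 = l + m) (h₂ : s + 1 = a + n) (h₃ : b + 1 = m + n)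
    (h₄ : s + 1 = l + b) (i : Fin l) (j : Fin m) (q : Fin a), q.1 = i.1 + j.1 →
    ∀ (α : obj l) (β : obj m) (γ : obj n),
      comp h₂ q (comp h₁ i α β) γ = comp h₄ i α (comp h₃ j β γ)
  /-- `(α ∘ᵢ β) ∘_{c+m-1} γ = (α ∘_c γ) ∘ᵢ β` for `i < c`, where `m` is the arity of `β` -/
  comm : ∀ {l m n a b s : ℕ} (h₁ : a + 1 = l + m) (h₂ : s + 1 = a + n) (h₃ : b + 1 = l + n)
    (h₄ : s + 1 = b + m) (i c : Fin l), i.1 < c.1 → ∀ (q : Fin a), q.1 + 1 = c.1 + m →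
    ∀ (q' : Fin b), q'.1 = i.1 → ∀ (α : obj l) (β : obj m) (γ : obj n),
      comp h₂ q (comp h₁ i α β) γ = comp h₄ q' (comp h₃ c α γ) β
  comp_act : ∀ {m n r : ℕ} (h : r + 1 = m + n) (i : Fin m) (μ : obj m) (ν : obj n)
    (σ : Equiv.Perm (Fin n)), comp h i μ (act σ ν) = act (permComp h 1 i σ) (comp h i μ ν)
  act_comp : ∀ {m n r : ℕ} (h : r + 1 = m + n) (i : Fin m) (μ : obj m) (ν : obj n)
    (φ : Equiv.Perm (Fin m)),
      comp h i (act φ μ) ν = act (permComp h φ i 1) (comp h (φ i) μ ν)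

attribute [instance] SymOperad.acg SymOperad.mod

namespace SymOperad

variable {k : Type u} [CommRing k]

/-! ## Endomorphisms and automorphisms -/

/-- An endomorphism of an operad: a family of `k`-linear maps `P n → P n` that preserves the
identity, the symmetric group actions and the partial compositions. -/
@[ext]
structure EndHom (P : SymOperad.{u, v} k) where
  app : ∀ n, P.obj n →ₗ[k] P.obj n
  app_one : app 1 P.one = P.one
  app_act : ∀ {n : ℕ} (σ : Equiv.Perm (Fin n)) (θ : P.obj n),
    app n (P.act σ θ) = P.act σ (app n θ)
  app_comp : ∀ {m n r : ℕ} (h : r + 1 = m + n) (i : Fin m) (μ : P.obj m) (ν : P.obj n),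
    app r (P.comp h i μ ν) = P.comp h i (app m μ) (app n ν)

/-- Endomorphisms form a monoid under composition. -/
instance (P : SymOperad.{u, v} k) : Monoid P.EndHom where
  mul Φ Ψ :=
    { app := fun n => (Φ.app n).comp (Ψ.app n)
      app_one := by simp [Ψ.app_one, Φ.app_one]
      app_act := fun σ θ => by simp [Ψ.app_act, Φ.app_act]
      app_comp := fun h i μ ν => by simp [Ψ.app_comp, Φ.app_comp] }
  one :=
    { app := fun _ => LinearMap.id
      app_one := rfl
      app_act := fun _ _ => rfl
      app_comp := fun _ _ _ _ => rfl }
  mul_assoc _ _ _ := rfl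
  one_mul _ := rfl
  mul_one _ := rfl

/-- The automorphism group: the invertible endomorphisms. -/
abbrev AutGroup (P : SymOperad.{u, v} k) : Type v := (P.EndHom)ˣ

theorem EndHom.mul_app (P : SymOperad.{u, v} k) (Φ Ψ : P.EndHom) (n : ℕ) (θ : P.obj n) :
    (Φ * Ψ).app n θ = Φ.app n (Ψ.app n θ) := rfl

theorem EndHom.one_app (P : SymOperad.{u, v} k) (n : ℕ) (θ : P.obj n) :
    (1 : P.EndHom).app n θ = θ := rfl

/-- The superfluous endomorphism `θ ↦ c ^ (n - 1) θ`, for `θ` of arity `n` and a unit `c`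
(the exponent is an integer: it is `-1` in arity `0`). -/
def scaleEnd (P : SymOperad.{u, v} k) (c : kˣ) : P.EndHom where
  app n := ((c ^ ((n : ℤ) - 1) : kˣ) : k) • LinearMap.id
  app_one := by simp
  app_act σ θ := by simp
  app_comp {m n r} h i μ ν := by
    have e : ((r : ℤ) - 1) = ((n : ℤ) - 1) + ((m : ℤ) - 1) := by omega
    simp [smul_smul, e, zpow_add]

/-- The superfluous automorphisms, as a group homomorphism from the units of `k`. -/
def scale (P : SymOperad.{u, v} k) : kˣ →* P.AutGroup :=
  MonoidHom.toHomUnits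
    { toFun := P.scaleEnd
      map_one' := by
        ext n θ
        simp [scaleEnd, EndHom.one_app]
      map_mul' := fun c d => by
        ext n θ
        simp [scaleEnd, EndHom.mul_app, smul_smul, mul_zpow, mul_comm] }

/-! ## Full compositions -/

/-- Auxiliary to `compAll`: plug `x i` into the inputs `i < t`, starting with the last of them.
The arity of the result is `r = N - t + ∑ i, a i`. -/
def compAux (P : SymOperad.{u, v} k) : (t : ℕ) → {N r : ℕ} → (a : Fin t → ℕ) →
    (∀ i, P.obj (a i)) → t ≤ N → r + t = N + ∑ i, a i → P.obj N →ₗ[k] P.obj r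
  | 0, N, r, _, _, _, h =>
      have e : N = r := by simpa using h.symm
      e ▸ LinearMap.id
  | t + 1, N, _, a, x, ht, h =>
      (compAux P t (N := N + a (Fin.last t) - 1) (fun i => a i.castSucc) (fun i => x i.castSucc)
        (by omega) (by rw [Fin.sum_univ_castSucc] at h; omega)).comp
      ((P.comp (by omega) (⟨t, ht⟩ : Fin N)).flip (x (Fin.last t)))

/-- The full composition `θ ∘ (x₁, …, xₙ)`, of arity the sum of the arities of the `xᵢ`. -/
def compAll (P : SymOperad.{u, v} k) {n r : ℕ} (a : Fin n → ℕ) (x : ∀ i, P.obj (a i))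
    (h : ∑ i, a i = r) : P.obj n →ₗ[k] P.obj r :=
  P.compAux n a x le_rfl (by omega)

theorem compAux_succ (P : SymOperad.{u, v} k) {t N N' r : ℕ} (a : Fin (t + 1) → ℕ)
    (x : ∀ i, P.obj (a i)) (ht : t + 1 ≤ N) (h : r + (t + 1) = N + ∑ i, a i)
    (hN : N' + 1 = N + a (Fin.last t)) (ht' : t ≤ N')
    (h' : r + t = N' + ∑ i : Fin t, a i.castSucc) (θ : P.obj N) :
    P.compAux (t + 1) a x ht h θ =
      P.compAux t (fun i => a i.castSucc) (fun i => x i.castSucc) ht' h'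
        (P.comp hN ⟨t, ht⟩ θ (x (Fin.last t))) := by
  obtain rfl : N' = N + a (Fin.last t) - 1 := by omega
  rfl

/-! ## Inner and outer automorphisms -/

/-- `θ ∘ (x, …, x)` for `x` of arity `1`. -/
def plugAll (P : SymOperad.{u, v} k) (x : P.obj 1) (n : ℕ) : P.obj n →ₗ[k] P.obj n :=
  P.compAll (fun _ => 1) (fun _ => x) (by simp)

theorem compAux_plug_comm (P : SymOperad.{u, v} k) (x y : P.obj 1) {N : ℕ} (t : ℕ) (ht : t ≤ N)
    (h : N + t = N + ∑ _i : Fin t, 1) (j : Fin N) (hj : t ≤ j.1) (θ : P.obj N) :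
    P.compAux t (fun _ => 1) (fun _ => x) ht h (P.comp rfl j θ y) =
      P.comp rfl j (P.compAux t (fun _ => 1) (fun _ => x) ht h θ) y := by
  induction t generalizing θ with
  | zero => rfl
  | succ t ih =>
    rw [P.compAux_succ (N' := N) _ _ ht h rfl (by omega) (by simp),
      P.compAux_succ (N' := N) _ _ ht h rfl (by omega) (by simp), ← ih (by omega) (by simp) (by omega)]
    congr 1
    exact (P.comm rfl rfl rfl rfl ⟨t, ht⟩ j (by simp; omega) j rfl ⟨t, ht⟩ rfl θ x y).symm

theorem compAux_plug_mul (P : SymOperad.{u, v} k) (x y : P.obj 1) {N : ℕ} (t : ℕ) (ht : t ≤ N)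
    (h : N + t = N + ∑ _i : Fin t, 1) (θ : P.obj N) :
    P.compAux t (fun _ => 1) (fun _ => P.comp rfl 0 x y) ht h θ =
      P.compAux t (fun _ => 1) (fun _ => y) ht h
        (P.compAux t (fun _ => 1) (fun _ => x) ht h θ) := by
  induction t generalizing θ with
  | zero => rfl
  | succ t ih =>
    rw [P.compAux_succ (N' := N) _ _ ht h rfl (by omega) (by simp),
      P.compAux_succ (N' := N) _ _ ht h rfl (by omega) (by simp),
      P.compAux_succ (N' := N) _ _ ht h rfl (by omega) (by simp),
      ih, ← P.compAux_plug_comm x y t (by omega) (by simp) ⟨t, ht⟩ le_rfl]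
    congr 2
    exact (P.assoc rfl rfl rfl rfl ⟨t, ht⟩ 0 ⟨t, ht⟩ rfl θ x y).symm

theorem plugAll_mul (P : SymOperad.{u, v} k) (x y : P.obj 1) (n : ℕ) (θ : P.obj n) :
    P.plugAll (P.comp rfl 0 x y) n θ = P.plugAll y n (P.plugAll x n θ) :=
  P.compAux_plug_mul x y n _ _ θ

theorem plugAll_one (P : SymOperad.{u, v} k) (n : ℕ) (θ : P.obj n) : P.plugAll P.one n θ = θ := by
  have key : ∀ (t : ℕ) (ht : t ≤ n) (h : n + t = n + ∑ _i : Fin t, 1),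
      P.compAux t (fun _ => 1) (fun _ => P.one) ht h θ = θ := by
    intro t
    induction t with
    | zero => intro _ _; rfl
    | succ t ih =>
      intro ht h
      rw [P.compAux_succ (N' := n) _ _ ht h rfl (by omega) (by simp), P.comp_one]
      exact ih _ _
  exact key n _ _

theorem plugAll_comp (P : SymOperad.{u, v} k) (x y : P.obj 1) (n : ℕ) (θ : P.obj n) :
    P.plugAll x n (P.comp (by omega) 0 y θ) = P.comp (by omega) 0 y (P.plugAll x n θ) := by
  have key : ∀ (t : ℕ) (ht : t ≤ n) (h : n + t = n + ∑ _i : Fin t, 1) (θ : P.obj n),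
      P.compAux t (fun _ => 1) (fun _ => x) ht h (P.comp (by omega) 0 y θ) =
        P.comp (by omega) 0 y (P.compAux t (fun _ => 1) (fun _ => x) ht h θ) := by
    intro t
    induction t with
    | zero => intro _ _ _; rfl
    | succ t ih =>
      intro ht h θ
      rw [P.compAux_succ (N' := n) _ _ ht h rfl (by omega) (by simp),
        P.compAux_succ (N' := n) _ _ ht h rfl (by omega) (by simp), ← ih]
      congr 1
      exact P.assoc _ _ _ _ 0 ⟨t, ht⟩ ⟨t, ht⟩ (by simp) y θ x
  exact key n _ _ θ

theorem app_plugAll (P : SymOperad.{u, v} k) (Φ : P.EndHom) (x : P.obj 1) (n : ℕ) (θ : P.obj n) :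
    Φ.app n (P.plugAll x n θ) = P.plugAll (Φ.app 1 x) n (Φ.app n θ) := by
  have key : ∀ (t : ℕ) (ht : t ≤ n) (h : n + t = n + ∑ _i : Fin t, 1) (θ : P.obj n),
      Φ.app n (P.compAux t (fun _ => 1) (fun _ => x) ht h θ) =
        P.compAux t (fun _ => 1) (fun _ => Φ.app 1 x) ht h (Φ.app n θ) := by
    intro t
    induction t with
    | zero => intro _ _ _; rfl
    | succ t ih =>
      intro ht h θ
      rw [P.compAux_succ (N' := n) _ _ ht h rfl (by omega) (by simp),
        P.compAux_succ (N' := n) _ _ ht h rfl (by omega) (by simp), ih, Φ.app_comp]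
  exact key n _ _ θ

/-- `Φ` is the inner automorphism `θ ↦ (y ∘ θ) ∘ (x, …, x)` given by an invertible element `x` of
the algebra `P 1`, with inverse `y`. -/
def IsInnerBy (P : SymOperad.{u, v} k) (Φ : P.EndHom) (x y : P.obj 1) : Prop :=
  P.comp rfl 0 x y = P.one ∧ P.comp rfl 0 y x = P.one ∧
    ∀ (n : ℕ) (θ : P.obj n), Φ.app n θ = P.plugAll x n (P.comp (by omega) 0 y θ)

/-- The subgroup of inner automorphisms. -/
def IAut (P : SymOperad.{u, v} k) : Subgroup P.AutGroup where
  carrier := {Φ | ∃ x y : P.obj 1, P.IsInnerBy Φ.1 x y}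
  one_mem' := ⟨P.one, P.one, P.one_comp _ _, P.one_comp _ _, fun n θ => by
    rw [P.plugAll_one, P.one_comp]; rfl⟩
  mul_mem' := by
    rintro Φ Ψ ⟨x, y, hxy, hyx, hΦ⟩ ⟨x', y', hxy', hyx', hΨ⟩
    have key : ∀ a b c d : P.obj 1, P.comp rfl 0 b c = P.one → P.comp rfl 0 a d = P.one →
        P.comp (r := 1) rfl 0 (P.comp (r := 1) rfl 0 a b) (P.comp (r := 1) rfl 0 c d) = P.one := by
      intro a b c d h1 h2
      rw [P.assoc (b := 1) rfl rfl rfl rfl 0 0 0 rfl, ← P.assoc (a := 1) rfl rfl rfl rfl 0 0 0 rfl b,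
        h1, P.one_comp, h2]
    refine ⟨P.comp rfl 0 x' x, P.comp rfl 0 y y', key _ _ _ _ hxy hxy', key _ _ _ _ hyx' hyx, ?_⟩
    intro n θ
    rw [Units.val_mul, EndHom.mul_app, hΨ, hΦ, P.plugAll_mul, ← P.plugAll_comp]
    congr 2
    exact (P.assoc (b := n) rfl (by omega) (by omega) (by omega) 0 0 0 rfl y y' θ).symm
  inv_mem' := by
    rintro Φ ⟨x, y, hxy, hyx, hΦ⟩
    refine ⟨y, x, hyx, hxy, fun n θ => ?_⟩
    have h1 : Φ.1.app n (P.plugAll y n (P.comp (by omega) 0 x θ)) = θ := by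
      rw [hΦ, ← P.plugAll_comp, ← P.plugAll_mul, hyx, P.plugAll_one,
        ← P.assoc (a := 1) rfl (by omega) (by omega) (by omega) 0 0 0 rfl y x θ, hyx, P.one_comp]
    have h2 : ∀ z, (Φ⁻¹).1.app n (Φ.1.app n z) = z := fun z => by
      rw [← EndHom.mul_app, Units.inv_mul, EndHom.one_app]
    conv_lhs => rw [← h1]
    rw [h2]

instance (P : SymOperad.{u, v} k) : P.IAut.Normal where
  conj_mem := by
    rintro Φ ⟨x, y, hxy, hyx, hΦ⟩ Ψ
    refine ⟨Ψ.1.app 1 x, Ψ.1.app 1 y, ?_, ?_, fun n θ => ?_⟩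
    · rw [← Ψ.1.app_comp, hxy, Ψ.1.app_one]
    · rw [← Ψ.1.app_comp, hyx, Ψ.1.app_one]
    · have h2 : Ψ.1.app n ((Ψ⁻¹).1.app n θ) = θ := by
        rw [← EndHom.mul_app, Units.mul_inv, EndHom.one_app]
      rw [Units.val_mul, Units.val_mul, EndHom.mul_app, EndHom.mul_app, hΦ, P.app_plugAll,
        Ψ.1.app_comp, h2]

/-- The outer automorphism group. -/
abbrev OAut (P : SymOperad.{u, v} k) : Type v := P.AutGroup ⧸ P.IAut

/-! ## Ideals, quotients and truncations -/

/-- An (operadic) ideal: submodules of the `P n`, stable under the symmetric groups and under partial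
composition with arbitrary elements on either side. -/
structure OpIdeal (P : SymOperad.{u, v} k) where
  sub : ∀ n, Submodule k (P.obj n)
  act_mem : ∀ {n : ℕ} (σ : Equiv.Perm (Fin n)) (θ : P.obj n), θ ∈ sub n → P.act σ θ ∈ sub n
  comp_mem_left : ∀ {m n r : ℕ} (h : r + 1 = m + n) (i : Fin m) (μ : P.obj m) (ν : P.obj n),
    μ ∈ sub m → P.comp h i μ ν ∈ sub r
  comp_mem_right : ∀ {m n r : ℕ} (h : r + 1 = m + n) (i : Fin m) (μ : P.obj m) (ν : P.obj n),
    ν ∈ sub n → P.comp h i μ ν ∈ sub r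

/-- The composition induced on the quotient by an ideal. -/
def quotComp (P : SymOperad.{u, v} k) (I : P.OpIdeal) {m n r : ℕ} (h : r + 1 = m + n) (i : Fin m) :
    (P.obj m ⧸ I.sub m) →ₗ[k] (P.obj n ⧸ I.sub n) →ₗ[k] (P.obj r ⧸ I.sub r) :=
  LinearMap.flip <| (I.sub n).liftQ
    (LinearMap.flip <| (I.sub m).liftQ ((P.comp h i).compr₂ (I.sub r).mkQ) (by
      intro μ hμ
      ext ν
      simpa using I.comp_mem_left h i μ ν hμ)) (by
    intro ν hν
    ext μ
    exact (Submodule.Quotient.mk_eq_zero _).mpr (I.comp_mem_right h i μ ν hν))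

theorem quotComp_mk (P : SymOperad.{u, v} k) (I : P.OpIdeal) {m n r : ℕ} (h : r + 1 = m + n)
    (i : Fin m) (μ : P.obj m) (ν : P.obj n) :
    P.quotComp I h i (Submodule.Quotient.mk μ) (Submodule.Quotient.mk ν) =
      Submodule.Quotient.mk (P.comp h i μ ν) := rfl

/-- The quotient operad `P / I`. -/
def quot (P : SymOperad.{u, v} k) (I : P.OpIdeal) : SymOperad.{u, v} k where
  obj n := P.obj n ⧸ I.sub n
  act {n} σ := (I.sub n).mapQ (I.sub n) (P.act σ) (fun θ hθ => I.act_mem σ θ hθ)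
  one := Submodule.Quotient.mk P.one
  comp h i := P.quotComp I h i
  act_one θ := by
    obtain ⟨θ, rfl⟩ := Submodule.Quotient.mk_surjective _ θ
    simp [P.act_one]
  act_mul σ τ θ := by
    obtain ⟨θ, rfl⟩ := Submodule.Quotient.mk_surjective _ θ
    simp [P.act_mul]
  comp_one h i θ := by
    obtain ⟨θ, rfl⟩ := Submodule.Quotient.mk_surjective _ θ
    rw [quotComp_mk, P.comp_one]
  one_comp h θ := by
    obtain ⟨θ, rfl⟩ := Submodule.Quotient.mk_surjective _ θ
    rw [quotComp_mk, P.one_comp]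
  assoc h₁ h₂ h₃ h₄ i j q hq α β γ := by
    obtain ⟨α, rfl⟩ := Submodule.Quotient.mk_surjective _ α
    obtain ⟨β, rfl⟩ := Submodule.Quotient.mk_surjective _ β
    obtain ⟨γ, rfl⟩ := Submodule.Quotient.mk_surjective _ γ
    simp only [quotComp_mk]
    rw [P.assoc h₁ h₂ h₃ h₄ i j q hq]
  comm h₁ h₂ h₃ h₄ i c hic q hq q' hq' α β γ := by
    obtain ⟨α, rfl⟩ := Submodule.Quotient.mk_surjective _ α
    obtain ⟨β, rfl⟩ := Submodule.Quotient.mk_surjective _ β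
    obtain ⟨γ, rfl⟩ := Submodule.Quotient.mk_surjective _ γ
    simp only [quotComp_mk]
    rw [P.comm h₁ h₂ h₃ h₄ i c hic q hq q' hq']
  comp_act h i μ ν σ := by
    obtain ⟨μ, rfl⟩ := Submodule.Quotient.mk_surjective _ μ
    obtain ⟨ν, rfl⟩ := Submodule.Quotient.mk_surjective _ ν
    simp only [Submodule.mapQ_apply, quotComp_mk]
    rw [P.comp_act]
  act_comp h i μ ν φ := by
    obtain ⟨μ, rfl⟩ := Submodule.Quotient.mk_surjective _ μ
    obtain ⟨ν, rfl⟩ := Submodule.Quotient.mk_surjective _ ν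
    simp only [Submodule.mapQ_apply, quotComp_mk]
    rw [P.act_comp]

/-- `1₁ = 1` and `1₀ = u`, indexed by the truth value of membership in a subset. -/
def unitAt (P : SymOperad.{u, v} k) (u : P.obj 0) : (b : Bool) → P.obj b.toNat
  | true => P.one
  | false => u

/-- The restriction operator `π^I : P n → P |I|`, `θ ↦ θ ∘ (1_{χ(1)}, …, 1_{χ(n)})`, where `χ` is the
characteristic function of the subset `I` of the set of inputs and `u = 1₀` is the `0`-unit. -/
def restr (P : SymOperad.{u, v} k) (u : P.obj 0) {n s : ℕ} (χ : Fin n → Bool)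
    (h : ∑ i, (χ i).toNat = s) : P.obj n →ₗ[k] P.obj s :=
  P.compAll (fun i => (χ i).toNat) (fun i => P.unitAt u (χ i)) h

/-- The arity `n` part of the `K`-th truncation ideal: for `n ≥ K` the intersection of the kernels of
the restriction operators `π^I` over all `I` with `|I| = K - 1`, and `0` for `n < K`.
For `K = 0` the intersection is empty, so that one gets all of `P`. -/
def truncSub (P : SymOperad.{u, v} k) (u : P.obj 0) (K n : ℕ) : Submodule k (P.obj n) :=
  if K ≤ n then
    ⨅ (s : ℕ) (_ : s + 1 = K) (χ : Fin n → Bool) (h : ∑ i, (χ i).toNat = s),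
      LinearMap.ker (P.restr u χ h)
  else ⊥

theorem mem_truncSub_of_lt (P : SymOperad.{u, v} k) (u : P.obj 0) {K n : ℕ} (h : n < K)
    (θ : P.obj n) : θ ∈ P.truncSub u K n ↔ θ = 0 := by
  simp [truncSub, Nat.not_le.mpr h]

theorem mem_truncSub (P : SymOperad.{u, v} k) (u : P.obj 0) {K n : ℕ} (hK : K ≤ n)
    (θ : P.obj n) : θ ∈ P.truncSub u K n ↔
      ∀ (s : ℕ) (_ : s + 1 = K) (χ : Fin n → Bool) (h : ∑ i, (χ i).toNat = s),
        P.restr u χ h θ = 0 := by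
  simp [truncSub, hK, Submodule.mem_iInf]

theorem comp_unitAt_false (P : SymOperad.{u, v} k) (u : P.obj 0) {N N' : ℕ} (b : Bool)
    (hb : b = false) (hN : N' + 1 = N + b.toNat) (hN' : N' + 1 = N + 0) (i : Fin N)
    (θ : P.obj N) : P.comp hN i θ (P.unitAt u b) = P.comp hN' i θ u := by
  subst hb
  rfl

theorem compAux_insert (P : SymOperad.{u, v} k) (u : P.obj 0) (t : ℕ) {N N' r : ℕ}
    (hN : N' + 1 = N + 0) (ht : t + 1 ≤ N) (ht' : t ≤ N') (χ : Fin (t + 1) → Bool)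
    (χ' : Fin t → Bool) (i : Fin (t + 1)) (hi : χ i = false)
    (hχ : ∀ j, χ' j = χ (i.succAbove j)) (h : r + (t + 1) = N + ∑ i, (χ i).toNat)
    (h' : r + t = N' + ∑ i, (χ' i).toNat) (p : Fin N) (hp : p.1 = i.1) (θ : P.obj N) :
    P.compAux (t + 1) (fun i => (χ i).toNat) (fun i => P.unitAt u (χ i)) ht h θ =
      P.compAux t (fun i => (χ' i).toNat) (fun i => P.unitAt u (χ' i)) ht' h'
        (P.comp hN p θ u) := by
  induction t generalizing N N' with
  | zero =>
    obtain rfl : i = Fin.last 0 := Fin.ext (by have := i.2; simp)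
    obtain rfl : χ' = fun j => χ j.castSucc := funext fun j => j.elim0
    obtain rfl : p = ⟨0, ht⟩ := Fin.ext hp
    rw [P.compAux_succ (N' := N') _ _ ht h (by rw [hi]; exact hN) ht' h',
      P.comp_unitAt_false u _ hi _ hN]
  | succ t ih =>
    rcases Fin.eq_castSucc_or_eq_last i with ⟨i, rfl⟩ | rfl
    · have hlast : χ' (Fin.last t) = χ (Fin.last (t + 1)) := by
        rw [hχ, Fin.succAbove_of_le_castSucc, Fin.succ_last]
        exact Fin.le_last i
      have h0 : ∀ j : Fin t, χ' j.castSucc = χ (i.succAbove j).castSucc := by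
        intro j
        rw [hχ, Fin.castSucc_succAbove_castSucc]
      have hs := Fin.sum_univ_castSucc (fun i => (χ i).toNat)
      have hs' := Fin.sum_univ_castSucc (fun i => (χ' i).toNat)
      have e1 := P.compAux_succ (N' := N + (χ (Fin.last (t + 1))).toNat - 1) (fun i => (χ i).toNat)
        (fun i => P.unitAt u (χ i)) ht h (by omega) (by omega) (by omega) θ
      have e2 := P.compAux_succ (N' := N' + (χ' (Fin.last t)).toNat - 1) (fun i => (χ' i).toNat)
        (fun i => P.unitAt u (χ' i)) ht' h' (by omega) (by omega) (by omega) (P.comp hN p θ u)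
      have hp' : p.1 = i.1 := hp
      have hit := i.2
      have g1 : N' + (χ' (Fin.last t)).toNat - 1 + 1 = N + (χ (Fin.last (t + 1))).toNat - 1 + 0 := by
        rw [hlast]
        omega
      have g2 : r + (t + 1) = N + (χ (Fin.last (t + 1))).toNat - 1 +
          ∑ i : Fin (t + 1), (χ i.castSucc).toNat := by omega
      have g3 : r + t = N' + (χ' (Fin.last t)).toNat - 1 +
          ∑ i : Fin t, (χ' i.castSucc).toNat := by omega
      rw [e1, e2]
      refine (ih g1 (by omega) (by omega) (fun j => χ j.castSucc) (fun j => χ' j.castSucc) i hi h0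
        g2 g3 ⟨i.1, by omega⟩ rfl _).trans ?_
      congr 1
      have key : ∀ (b b' : Bool), b' = b → ∀ (M : ℕ) (g1 : M + 1 = (N + b.toNat - 1) + 0)
          (g2 : N + b.toNat - 1 + 1 = N + b.toNat) (g3 : M + 1 = N' + b'.toNat)
          (j1 : Fin (N + b.toNat - 1)) (_ : j1.1 = i.1) (j2 : Fin N) (_ : j2.1 = t + 1)
          (j3 : Fin N') (_ : j3.1 = t),
          P.comp g1 j1 (P.comp g2 j2 θ (P.unitAt u b)) u =
            P.comp g3 j3 (P.comp hN p θ u) (P.unitAt u b') := by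
        intro b b' hb M g1 g2 g3 j1 hj1 j2 hj2 j3 hj3
        subst hb
        exact (P.comm hN g3 g2 g1 p j2 (by omega) j3 (by omega) j1 (by omega) θ u _).symm
      exact key _ _ hlast _ _ _ _ _ rfl _ rfl _ rfl
    · obtain rfl : χ' = fun j => χ j.castSucc := funext fun j => by
        rw [hχ, Fin.succAbove_last]
      obtain rfl : p = ⟨t + 1, ht⟩ := Fin.ext hp
      rw [P.compAux_succ (N' := N') _ _ ht h (by rw [hi]; exact hN) ht' h',
        P.comp_unitAt_false u _ hi _ hN]

theorem restr_true (P : SymOperad.{u, v} k) (u : P.obj 0) {n : ℕ}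
    (h : ∑ _i : Fin n, Bool.toNat true = n) (θ : P.obj n) :
    P.restr u (fun _ => true) h θ = θ :=
  P.plugAll_one n θ

/-- Recursive description of the truncation ideals. -/
theorem mem_truncSub_succ (P : SymOperad.{u, v} k) (u : P.obj 0) {K n : ℕ} (hK : K ≤ n + 1)
    (θ : P.obj (n + 1)) :
    θ ∈ P.truncSub u K (n + 1) ↔
      ∀ i : Fin (n + 1), P.comp (r := n) (by omega) i θ u ∈ P.truncSub u K n := by
  have ins : ∀ (s : ℕ) (χ : Fin (n + 1) → Bool) (χ' : Fin n → Bool) (i : Fin (n + 1)),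
      χ i = false → (∀ j, χ' j = χ (i.succAbove j)) → ∀ (h : ∑ i, (χ i).toNat = s)
      (h' : ∑ i, (χ' i).toNat = s), P.restr u χ h θ = P.restr u χ' h' (P.comp (r := n) (by omega) i θ u) := by
    intro s χ χ' i hi hχ h h'
    exact P.compAux_insert u n (by omega) le_rfl le_rfl χ χ' i hi hχ (by omega) (by omega) i rfl θ
  rw [P.mem_truncSub u hK]
  constructor
  · intro hθ i
    have main : ∀ (s : ℕ) (_ : s + 1 = K) (χ' : Fin n → Bool) (h' : ∑ i, (χ' i).toNat = s),
        P.restr u χ' h' (P.comp (r := n) (by omega) i θ u) = 0 := by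
      intro s hs χ' h'
      rw [← ins s (i.insertNth false χ') χ' i (by simp) (by simp)
        (by rw [Fin.sum_univ_succAbove _ i]; simpa using h') h']
      exact hθ s hs _ _
    rcases Nat.lt_or_ge n K with hn | hn
    · rw [P.mem_truncSub_of_lt u hn]
      have := main n (by omega) (fun _ => true) (by simp)
      rwa [P.restr_true] at this
    · rwa [P.mem_truncSub u hn]
  · intro hθ s hs χ h
    obtain ⟨i, hi⟩ : ∃ i, χ i = false := by
      by_contra hcon
      have hall : ∀ i, χ i = true := fun i => by
        cases hc : χ i
        · exact absurd ⟨i, hc⟩ hcon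
        · rfl
      simp [hall] at h
      omega
    have h' : ∑ j, (χ (i.succAbove j)).toNat = s := by
      rw [Fin.sum_univ_succAbove _ i, hi] at h
      simpa using h
    rw [ins s χ (fun j => χ (i.succAbove j)) i hi (fun _ => rfl) h h']
    rcases Nat.lt_or_ge n K with hn | hn
    · rw [(P.mem_truncSub_of_lt u hn _).mp (hθ i), map_zero]
    · exact (P.mem_truncSub u hn _).mp (hθ i) s hs _ _

/-- Inserting an arity `0` element into a partial composite. -/
theorem comp_comp_unit (P : SymOperad.{u, v} k) (u : P.obj 0) {m n r : ℕ}
    (h : r + 1 + 1 = m + n) (i : Fin m) (p : Fin (r + 1)) (μ : P.obj m) (ν : P.obj n)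
    {C : P.obj r → Prop}
    (h1 : ∀ (n' : ℕ) (hn : n = n' + 1) (hr : r + 1 = m + n') (j : Fin n),
      C (P.comp hr i μ (P.comp (by omega) j ν u)))
    (h2 : ∀ (m' : ℕ) (hm : m = m' + 1) (hr : r + 1 = m' + n) (q : Fin m) (i' : Fin m'),
      C (P.comp hr i' (P.comp (by omega) q μ u) ν)) :
    C (P.comp (r := r) (by omega) p (P.comp h i μ ν) u) := by
  have hi := i.2
  have hp := p.2
  rcases Nat.lt_or_ge p.1 i.1 with hpi | hpi
  · have e := P.comm (a := m - 1) (s := r) (b := r + 1) (by omega) (by omega) h rfl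
      ⟨p.1, by omega⟩ i hpi ⟨i.1 - 1, by omega⟩ (by simp; omega) p rfl μ u ν
    rw [← e]
    exact h2 (m - 1) (by omega) (by omega) _ _
  · rcases Nat.lt_or_ge p.1 (i.1 + n) with hpn | hpn
    · have e := P.assoc (b := n - 1) (s := r) h rfl (by omega) (by omega) i
        ⟨p.1 - i.1, by omega⟩ p (by simp; omega) μ ν u
      rw [e]
      exact h1 (n - 1) (by omega) (by omega) _
    · have e := P.comm (a := r + 1) (s := r) (b := m - 1) h rfl (by omega) (by omega)
        i ⟨p.1 + 1 - n, by omega⟩ (by simp; omega) p (by simp; omega) ⟨i.1, by omega⟩ rfl μ ν u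
      rw [e]
      exact h2 (m - 1) (by omega) (by omega) _ _

theorem truncSub_zero (P : SymOperad.{u, v} k) (u : P.obj 0) (n : ℕ) : P.truncSub u 0 n = ⊤ := by
  simp [truncSub]

/-- The `K`-th truncation ideal of an operad with `P 0` spanned by the `0`-unit `u = 1₀`. -/
def truncIdeal (P : SymOperad.{u, v} k) (u : P.obj 0) (hu : ∀ x : P.obj 0, ∃ c : k, x = c • u)
    (K : ℕ) : P.OpIdeal where
  sub := P.truncSub u K
  act_mem {n} σ θ hθ := by
    rcases Nat.eq_zero_or_pos K with rfl | hK
    · simp [truncSub_zero]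
    induction n with
    | zero =>
      rw [P.mem_truncSub_of_lt u hK] at hθ ⊢
      simp [hθ]
    | succ n ih =>
      rcases Nat.lt_or_ge (n + 1) K with hn | hn
      · rw [P.mem_truncSub_of_lt u hn] at hθ ⊢
        simp [hθ]
      · rw [P.mem_truncSub_succ u hn] at hθ ⊢
        intro i
        rw [P.act_comp]
        exact ih _ _ (hθ _)
  comp_mem_left {m n r} h i μ ν hμ := by
    rcases Nat.eq_zero_or_pos K with rfl | hK
    · simp [truncSub_zero]
    induction r generalizing m n with
    | zero =>
      obtain ⟨rfl, rfl⟩ : m = 1 ∧ n = 0 := by have := i.2; omega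
      obtain ⟨c, rfl⟩ := hu ν
      rw [map_smul]
      refine Submodule.smul_mem _ _ ?_
      rcases Nat.lt_or_ge 1 K with h1 | h1
      · rw [P.mem_truncSub_of_lt u h1] at hμ
        simp [hμ]
      · exact (P.mem_truncSub_succ u h1 μ).mp hμ i
    | succ r ih =>
      rcases Nat.lt_or_ge m K with hm | hm
      · rw [P.mem_truncSub_of_lt u hm] at hμ
        simp [hμ]
      rcases Nat.lt_or_ge (r + 1) K with hr | hr
      · obtain rfl : n = 0 := by omega
        obtain rfl : m = r + 1 + 1 := by omega
        obtain ⟨c, rfl⟩ := hu ν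
        rw [map_smul]
        exact Submodule.smul_mem _ _ ((P.mem_truncSub_succ u hm μ).mp hμ i)
      · rw [P.mem_truncSub_succ u hr]
        intro p
        refine P.comp_comp_unit u h i p μ ν (C := fun x => x ∈ P.truncSub u K r) ?_ ?_
        · intro n' hn hr' j
          exact ih _ _ _ _ hμ
        · rintro m' rfl hr' q i'
          exact ih _ _ _ _ ((P.mem_truncSub_succ u hm μ).mp hμ q)
  comp_mem_right {m n r} h i μ ν hν := by
    rcases Nat.eq_zero_or_pos K with rfl | hK
    · simp [truncSub_zero]
    induction r generalizing m n with
    | zero =>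
      obtain ⟨rfl, rfl⟩ : m = 1 ∧ n = 0 := by have := i.2; omega
      rw [P.mem_truncSub_of_lt u hK] at hν
      simp [hν]
    | succ r ih =>
      rcases Nat.lt_or_ge n K with hn | hn
      · rw [P.mem_truncSub_of_lt u hn] at hν
        simp [hν]
      · rw [P.mem_truncSub_succ u (by have := i.2; omega)]
        intro p
        refine P.comp_comp_unit u h i p μ ν (C := fun x => x ∈ P.truncSub u K r) ?_ ?_
        · rintro n' rfl hr' j
          exact ih _ _ _ _ ((P.mem_truncSub_succ u hn ν).mp hν j)
        · intro m' hm hr' q i'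
          exact ih _ _ _ _ hν

/-- `θ` becomes a multiple of `u = 1₀` when `u` is plugged into all the inputs of `θ`. -/
def Collapses (P : SymOperad.{u, v} k) (u : P.obj 0) : (n : ℕ) → P.obj n → Prop
  | 0, θ => ∃ c : k, θ = c • u
  | n + 1, θ => ∀ i : Fin (n + 1), Collapses P u n (P.comp (r := n) (by omega) i θ u)

theorem Collapses.add (P : SymOperad.{u, v} k) (u : P.obj 0) {n : ℕ} {x y : P.obj n}
    (hx : P.Collapses u n x) (hy : P.Collapses u n y) : P.Collapses u n (x + y) := by
  induction n with
  | zero =>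
    obtain ⟨c, rfl⟩ := hx
    obtain ⟨d, rfl⟩ := hy
    exact ⟨c + d, (add_smul _ _ _).symm⟩
  | succ n ih =>
    intro i
    rw [map_add, LinearMap.add_apply]
    exact ih (hx i) (hy i)

theorem Collapses.smul (P : SymOperad.{u, v} k) (u : P.obj 0) {n : ℕ} (c : k) {x : P.obj n}
    (hx : P.Collapses u n x) : P.Collapses u n (c • x) := by
  induction n with
  | zero =>
    obtain ⟨d, rfl⟩ := hx
    exact ⟨c * d, smul_smul _ _ _⟩
  | succ n ih =>
    intro i
    rw [map_smul, LinearMap.smul_apply]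
    exact ih (hx i)

theorem Collapses.zero (P : SymOperad.{u, v} k) (u : P.obj 0) (n : ℕ) :
    P.Collapses u n (0 : P.obj n) := by
  induction n with
  | zero => exact ⟨0, (zero_smul _ _).symm⟩
  | succ n ih =>
    intro i
    simpa using ih

theorem Collapses.act (P : SymOperad.{u, v} k) (u : P.obj 0) {n : ℕ} (σ : Equiv.Perm (Fin n))
    {x : P.obj n} (hx : P.Collapses u n x) : P.Collapses u n (P.act σ x) := by
  induction n with
  | zero =>
    obtain rfl : σ = 1 := Subsingleton.elim _ _
    rwa [P.act_one]
  | succ n ih =>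
    intro i
    rw [P.act_comp]
    exact ih _ (hx _)

theorem Collapses.comp (P : SymOperad.{u, v} k) (u : P.obj 0) {m n r : ℕ} (h : r + 1 = m + n)
    (i : Fin m) {μ : P.obj m} {ν : P.obj n} (hμ : P.Collapses u m μ) (hν : P.Collapses u n ν) :
    P.Collapses u r (P.comp h i μ ν) := by
  induction r generalizing m n with
  | zero =>
    obtain ⟨rfl, rfl⟩ : m = 1 ∧ n = 0 := by have := i.2; omega
    obtain ⟨c, rfl⟩ := hν
    rw [map_smul]
    exact Collapses.smul P u c (hμ i)
  | succ r ih =>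
    intro p
    refine P.comp_comp_unit u h i p μ ν (C := fun x => P.Collapses u r x) ?_ ?_
    · rintro n' rfl hr' j
      exact ih _ _ hμ (hν j)
    · rintro m' rfl hr' q i'
      exact ih _ _ (hμ q) hν

end SymOperad

/-! ## The operad of unital associative algebras -/

namespace AsOperad

variable (k : Type u) [CommRing k]

/-- Bilinear extension of the partial composition of permutations. -/
noncomputable def comp {m n r : ℕ} (h : r + 1 = m + n) (i : Fin m) :
    (Equiv.Perm (Fin m) →₀ k) →ₗ[k] (Equiv.Perm (Fin n) →₀ k) →ₗ[k]
      (Equiv.Perm (Fin r) →₀ k) :=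
  Finsupp.lsum k fun φ =>
    LinearMap.toSpanSingleton k _ (Finsupp.lmapDomain k k (permComp h φ i))

theorem comp_single {m n r : ℕ} (h : r + 1 = m + n) (i : Fin m) (φ : Equiv.Perm (Fin m))
    (σ : Equiv.Perm (Fin n)) (a b : k) :
    comp k h i (Finsupp.single φ a) (Finsupp.single σ b) =
      Finsupp.single (permComp h φ i σ) (a * b) := by
  simp [comp]

/-- The operad `As` of unital associative algebras: `As n` is the free module `k S_n` on the
permutations of the `n` inputs, with right multiplication as the right action and with the bilinear
extension of the partial composition of permutations. -/
noncomputable def As : SymOperad.{u, u} k where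
  obj n := Equiv.Perm (Fin n) →₀ k
  act σ := Finsupp.lmapDomain k k (fun φ => φ * σ)
  one := Finsupp.single 1 1
  comp h i := comp k h i
  act_one θ := by
    induction θ using Finsupp.induction_linear with
    | zero => simp
    | add x y hx hy => simp only [map_add, hx, hy]
    | single φ a => simp
  act_mul σ τ θ := by
    induction θ using Finsupp.induction_linear with
    | zero => simp
    | add x y hx hy => simp only [map_add, hx, hy]
    | single φ a => simp [mul_assoc]
  comp_one h i θ := by
    induction θ using Finsupp.induction_linear with
    | zero => simp
    | add x y hx hy => simp only [map_add, LinearMap.add_apply, hx, hy]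
    | single φ a => rw [comp_single, permComp_one_right, mul_one]
  one_comp h θ := by
    induction θ using Finsupp.induction_linear with
    | zero => simp
    | add x y hx hy => simp only [map_add, hx, hy]
    | single φ a => rw [comp_single, permComp_one_left, one_mul]
  assoc h₁ h₂ h₃ h₄ i j q hq α β γ := by
    induction α using Finsupp.induction_linear with
    | zero => simp
    | add x y hx hy => simp only [map_add, LinearMap.add_apply, hx, hy]
    | single α a =>
      induction β using Finsupp.induction_linear with
      | zero => simp
      | add x y hx hy => simp only [map_add, LinearMap.add_apply, hx, hy]
      | single β b =>
        induction γ using Finsupp.induction_linear with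
        | zero => simp
        | add x y hx hy => simp only [map_add, hx, hy]
        | single γ c =>
          simp only [comp_single]
          rw [permComp_assoc h₁ h₂ h₃ h₄ i j q hq, mul_assoc]
  comm h₁ h₂ h₃ h₄ i c hic q hq q' hq' α β γ := by
    induction α using Finsupp.induction_linear with
    | zero => simp
    | add x y hx hy => simp only [map_add, LinearMap.add_apply, hx, hy]
    | single α a =>
      induction β using Finsupp.induction_linear with
      | zero => simp
      | add x y hx hy => simp only [map_add, LinearMap.add_apply, hx, hy]
      | single β b =>
        induction γ using Finsupp.induction_linear with
        | zero => simp
        | add x y hx hy => simp only [map_add, LinearMap.add_apply, hx, hy]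
        | single γ d =>
          simp only [comp_single]
          rw [permComp_comm h₁ h₂ h₃ h₄ i c hic q hq q' hq', mul_right_comm]
  comp_act h i μ ν σ := by
    induction μ using Finsupp.induction_linear with
    | zero => simp
    | add x y hx hy => simp only [map_add, LinearMap.add_apply, hx, hy]
    | single μ a =>
      induction ν using Finsupp.induction_linear with
      | zero => simp
      | add x y hx hy => simp only [map_add, hx, hy]
      | single ν b =>
        simp only [comp_single, Finsupp.lmapDomain_apply, Finsupp.mapDomain_single]
        have e := permComp_mul h μ 1 i ν σ
        rw [mul_one, Equiv.Perm.one_apply] at e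
        rw [e]
  act_comp h i μ ν φ := by
    induction μ using Finsupp.induction_linear with
    | zero => simp
    | add x y hx hy => simp only [map_add, LinearMap.add_apply, hx, hy]
    | single μ a =>
      induction ν using Finsupp.induction_linear with
      | zero => simp
      | add x y hx hy => simp only [map_add, hx, hy]
      | single ν b =>
        simp only [comp_single, Finsupp.lmapDomain_apply, Finsupp.mapDomain_single]
        have e := permComp_mul h μ φ i ν 1
        rw [mul_one] at e
        rw [e]

/-- The `0`-unit of `As`. -/
noncomputable def unit : (As k).obj 0 := Finsupp.single (1 : Equiv.Perm (Fin 0)) (1 : k)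

theorem unit_span (x : (As k).obj 0) : ∃ c : k, x = c • unit k := by
  refine ⟨(show Equiv.Perm (Fin 0) →₀ k from x) 1, ?_⟩
  apply Finsupp.ext
  intro σ
  obtain rfl : σ = 1 := Subsingleton.elim _ _
  change _ = ((show Equiv.Perm (Fin 0) →₀ k from x) 1 •
    (Finsupp.single (1 : Equiv.Perm (Fin 0)) (1 : k))) 1
  rw [Finsupp.smul_apply, Finsupp.single_eq_same, smul_eq_mul, mul_one]

/-- The quotient of `As` by its `K`-th truncation ideal. -/
noncomputable def AsTrunc (K : ℕ) : SymOperad.{u, u} k :=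
  (As k).quot ((As k).truncIdeal (unit k) (unit_span k) K)

end AsOperad

/-! ## Operads given by generators and relations -/

/-- Expressions of arity `n` in generators `X`, the operad operations, and `k`-linear
combinations. -/
inductive OpTerm (k : Type u) (X : ℕ → Type) : ℕ → Type u
  | gen {n : ℕ} (x : X n) : OpTerm k X n
  | one : OpTerm k X 1
  | zero (n : ℕ) : OpTerm k X n
  | add {n : ℕ} (a b : OpTerm k X n) : OpTerm k X n
  | smul {n : ℕ} (c : k) (a : OpTerm k X n) : OpTerm k X n
  | act {n : ℕ} (σ : Equiv.Perm (Fin n)) (a : OpTerm k X n) : OpTerm k X n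
  | comp {m n r : ℕ} (h : r + 1 = m + n) (i : Fin m) (a : OpTerm k X m) (b : OpTerm k X n) :
      OpTerm k X r

namespace OpTerm

variable {k : Type u} [CommRing k] {X : ℕ → Type}

/-- The congruence on expressions generated by the relations `R`, the module axioms, the linearity of
the operations and the operad axioms. -/
inductive Rel (R : ∀ n, OpTerm k X n → OpTerm k X n → Prop) :
    ∀ {n : ℕ}, OpTerm k X n → OpTerm k X n → Prop
  | of {n : ℕ} {a b : OpTerm k X n} : R n a b → Rel R a b
  | refl {n : ℕ} (a : OpTerm k X n) : Rel R a a
  | symm {n : ℕ} {a b : OpTerm k X n} : Rel R a b → Rel R b a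
  | trans {n : ℕ} {a b c : OpTerm k X n} : Rel R a b → Rel R b c → Rel R a c
  | add_congr {n : ℕ} {a a' b b' : OpTerm k X n} :
      Rel R a a' → Rel R b b' → Rel R (add a b) (add a' b')
  | smul_congr {n : ℕ} (c : k) {a a' : OpTerm k X n} : Rel R a a' → Rel R (smul c a) (smul c a')
  | act_congr {n : ℕ} (σ : Equiv.Perm (Fin n)) {a a' : OpTerm k X n} :
      Rel R a a' → Rel R (act σ a) (act σ a')
  | comp_congr {m n r : ℕ} (h : r + 1 = m + n) (i : Fin m) {a a' : OpTerm k X m}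
      {b b' : OpTerm k X n} : Rel R a a' → Rel R b b' → Rel R (comp h i a b) (comp h i a' b')
  | add_assoc {n : ℕ} (a b c : OpTerm k X n) : Rel R (add (add a b) c) (add a (add b c))
  | add_comm {n : ℕ} (a b : OpTerm k X n) : Rel R (add a b) (add b a)
  | zero_add {n : ℕ} (a : OpTerm k X n) : Rel R (add (zero n) a) a
  | zero_smul {n : ℕ} (a : OpTerm k X n) : Rel R (smul 0 a) (zero n)
  | one_smul {n : ℕ} (a : OpTerm k X n) : Rel R (smul 1 a) a
  | mul_smul {n : ℕ} (c d : k) (a : OpTerm k X n) : Rel R (smul (c * d) a) (smul c (smul d a))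
  | add_smul {n : ℕ} (c d : k) (a : OpTerm k X n) :
      Rel R (smul (c + d) a) (add (smul c a) (smul d a))
  | smul_add {n : ℕ} (c : k) (a b : OpTerm k X n) :
      Rel R (smul c (add a b)) (add (smul c a) (smul c b))
  | act_add {n : ℕ} (σ : Equiv.Perm (Fin n)) (a b : OpTerm k X n) :
      Rel R (act σ (add a b)) (add (act σ a) (act σ b))
  | act_smul {n : ℕ} (σ : Equiv.Perm (Fin n)) (c : k) (a : OpTerm k X n) :
      Rel R (act σ (smul c a)) (smul c (act σ a))
  | comp_add {m n r : ℕ} (h : r + 1 = m + n) (i : Fin m) (a : OpTerm k X m) (b b' : OpTerm k X n) :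
      Rel R (comp h i a (add b b')) (add (comp h i a b) (comp h i a b'))
  | comp_smul {m n r : ℕ} (h : r + 1 = m + n) (i : Fin m) (c : k) (a : OpTerm k X m)
      (b : OpTerm k X n) : Rel R (comp h i a (smul c b)) (smul c (comp h i a b))
  | add_comp {m n r : ℕ} (h : r + 1 = m + n) (i : Fin m) (a a' : OpTerm k X m) (b : OpTerm k X n) :
      Rel R (comp h i (add a a') b) (add (comp h i a b) (comp h i a' b))
  | smul_comp {m n r : ℕ} (h : r + 1 = m + n) (i : Fin m) (c : k) (a : OpTerm k X m)
      (b : OpTerm k X n) : Rel R (comp h i (smul c a) b) (smul c (comp h i a b))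
  | act_one {n : ℕ} (a : OpTerm k X n) : Rel R (act 1 a) a
  | act_mul {n : ℕ} (σ τ : Equiv.Perm (Fin n)) (a : OpTerm k X n) :
      Rel R (act (σ * τ) a) (act τ (act σ a))
  | comp_one {n : ℕ} (h : n + 1 = n + 1) (i : Fin n) (a : OpTerm k X n) : Rel R (comp h i a one) a
  | one_comp {n : ℕ} (h : n + 1 = 1 + n) (a : OpTerm k X n) : Rel R (comp h 0 one a) a
  | assoc {l m n a b s : ℕ} (h₁ : a + 1 = l + m) (h₂ : s + 1 = a + n) (h₃ : b + 1 = m + n)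
      (h₄ : s + 1 = l + b) (i : Fin l) (j : Fin m) (q : Fin a) (hq : q.1 = i.1 + j.1)
      (α : OpTerm k X l) (β : OpTerm k X m) (γ : OpTerm k X n) :
      Rel R (comp h₂ q (comp h₁ i α β) γ) (comp h₄ i α (comp h₃ j β γ))
  | comm {l m n a b s : ℕ} (h₁ : a + 1 = l + m) (h₂ : s + 1 = a + n) (h₃ : b + 1 = l + n)
      (h₄ : s + 1 = b + m) (i c : Fin l) (hic : i.1 < c.1) (q : Fin a) (hq : q.1 + 1 = c.1 + m)
      (q' : Fin b) (hq' : q'.1 = i.1) (α : OpTerm k X l) (β : OpTerm k X m) (γ : OpTerm k X n) :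
      Rel R (comp h₂ q (comp h₁ i α β) γ) (comp h₄ q' (comp h₃ c α γ) β)
  | comp_act {m n r : ℕ} (h : r + 1 = m + n) (i : Fin m) (μ : OpTerm k X m) (ν : OpTerm k X n)
      (σ : Equiv.Perm (Fin n)) :
      Rel R (comp h i μ (act σ ν)) (act (permComp h 1 i σ) (comp h i μ ν))
  | act_comp {m n r : ℕ} (h : r + 1 = m + n) (i : Fin m) (μ : OpTerm k X m) (ν : OpTerm k X n)
      (φ : Equiv.Perm (Fin m)) :
      Rel R (comp h i (act φ μ) ν) (act (permComp h φ i 1) (comp h (φ i) μ ν))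

/-- The setoid of the congruence `Rel R` in arity `n`. -/
def relSetoid (R : ∀ n, OpTerm k X n → OpTerm k X n → Prop) (n : ℕ) : Setoid (OpTerm k X n) where
  r := Rel R
  iseqv := ⟨Rel.refl, Rel.symm, Rel.trans⟩

/-- The arity `n` component of the operad presented by generators `X` and relations `R`. -/
def PObj (R : ∀ n, OpTerm k X n → OpTerm k X n → Prop) (n : ℕ) : Type u := Quotient (relSetoid R n)

variable (R : ∀ n, OpTerm k X n → OpTerm k X n → Prop)

/-- The class of an expression. -/
def cls {n : ℕ} (a : OpTerm k X n) : PObj R n := Quotient.mk (relSetoid R n) a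

theorem cls_eq {n : ℕ} {a b : OpTerm k X n} (h : Rel R a b) : cls R a = cls R b :=
  Quotient.sound h

theorem cls_surj {n : ℕ} (x : PObj R n) : ∃ a, cls R a = x := Quotient.exists_rep x

instance (n : ℕ) : Add (PObj R n) where
  add := Quotient.map₂ add (fun _ _ h _ _ h' => Rel.add_congr h h')

instance (n : ℕ) : Zero (PObj R n) where
  zero := cls R (zero n)

instance (n : ℕ) : Neg (PObj R n) where
  neg := Quotient.map (smul (-1)) (fun _ _ h => Rel.smul_congr (-1) h)

instance (n : ℕ) : AddCommGroup (PObj R n) where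
  nsmul := nsmulRec
  zsmul := zsmulRec
  add_assoc := by
    rintro ⟨a⟩ ⟨b⟩ ⟨c⟩
    exact cls_eq R (Rel.add_assoc a b c)
  zero_add := by
    rintro ⟨a⟩
    exact cls_eq R (Rel.zero_add a)
  add_zero := by
    rintro ⟨a⟩
    exact cls_eq R ((Rel.add_comm _ _).trans (Rel.zero_add a))
  add_comm := by
    rintro ⟨a⟩ ⟨b⟩
    exact cls_eq R (Rel.add_comm a b)
  neg_add_cancel := by
    rintro ⟨a⟩
    refine cls_eq R ?_
    have h1 : Rel R (add (smul (-1) a) (smul 1 a)) (zero n) := by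
      refine (Rel.add_smul (-1) 1 a).symm.trans ?_
      rw [neg_add_cancel]
      exact Rel.zero_smul a
    exact (Rel.add_congr (Rel.refl _) (Rel.one_smul a).symm).trans h1

instance (n : ℕ) : SMul k (PObj R n) where
  smul c := Quotient.map (smul c) (fun _ _ h => Rel.smul_congr c h)

theorem cls_add {n : ℕ} (a b : OpTerm k X n) : cls R (add a b) = cls R a + cls R b := rfl

theorem cls_smul {n : ℕ} (c : k) (a : OpTerm k X n) : cls R (smul c a) = c • cls R a := rfl

theorem cls_zero (n : ℕ) : cls R (zero n) = 0 := rfl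

instance (n : ℕ) : Module k (PObj R n) :=
  Module.ofMinimalAxioms
    (by
      rintro c ⟨a⟩ ⟨b⟩
      exact cls_eq R (Rel.smul_add c a b))
    (by
      rintro c d ⟨a⟩
      exact cls_eq R (Rel.add_smul c d a))
    (by
      rintro c d ⟨a⟩
      exact cls_eq R (Rel.mul_smul c d a))
    (by
      rintro ⟨a⟩
      exact cls_eq R (Rel.one_smul a))

/-- The operad presented by generators `X` and relations `R`. -/
def presented : SymOperad.{u, u} k where
  obj n := PObj R n
  act σ :=
    { toFun := Quotient.map (act σ) (fun _ _ h => Rel.act_congr σ h)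
      map_add' := by
        rintro ⟨a⟩ ⟨b⟩
        exact cls_eq R (Rel.act_add σ a b)
      map_smul' := by
        rintro c ⟨a⟩
        exact cls_eq R (Rel.act_smul σ c a) }
  one := cls R one
  comp h i := LinearMap.mk₂ k
    (Quotient.map₂ (comp h i) (fun _ _ e _ _ e' => Rel.comp_congr h i e e'))
    (by
      rintro ⟨a⟩ ⟨a'⟩ ⟨b⟩
      exact cls_eq R (Rel.add_comp h i a a' b))
    (by
      rintro c ⟨a⟩ ⟨b⟩
      exact cls_eq R (Rel.smul_comp h i c a b))
    (by
      rintro ⟨a⟩ ⟨b⟩ ⟨b'⟩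
      exact cls_eq R (Rel.comp_add h i a b b'))
    (by
      rintro c ⟨a⟩ ⟨b⟩
      exact cls_eq R (Rel.comp_smul h i c a b))
  act_one := by
    rintro n ⟨a⟩
    exact cls_eq R (Rel.act_one a)
  act_mul := by
    rintro n σ τ ⟨a⟩
    exact cls_eq R (Rel.act_mul σ τ a)
  comp_one := by
    rintro n h i ⟨a⟩
    exact cls_eq R (Rel.comp_one h i a)
  one_comp := by
    rintro n h ⟨a⟩
    exact cls_eq R (Rel.one_comp h a)
  assoc := by
    rintro l m n a b s h₁ h₂ h₃ h₄ i j q hq ⟨α⟩ ⟨β⟩ ⟨γ⟩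
    exact cls_eq R (Rel.assoc h₁ h₂ h₃ h₄ i j q hq α β γ)
  comm := by
    rintro l m n a b s h₁ h₂ h₃ h₄ i c hic q hq q' hq' ⟨α⟩ ⟨β⟩ ⟨γ⟩
    exact cls_eq R (Rel.comm h₁ h₂ h₃ h₄ i c hic q hq q' hq' α β γ)
  comp_act := by
    rintro m n r h i ⟨μ⟩ ⟨ν⟩ σ
    exact cls_eq R (Rel.comp_act h i μ ν σ)
  act_comp := by
    rintro m n r h i ⟨μ⟩ ⟨ν⟩ φ
    exact cls_eq R (Rel.act_comp h i μ ν φ)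

theorem presented_comp {m n r : ℕ} (h : r + 1 = m + n) (i : Fin m) (a : OpTerm k X m)
    (b : OpTerm k X n) : (presented R).comp h i (cls R a) (cls R b) = cls R (comp h i a b) := rfl

end OpTerm

/-! ## The Lie operad and the operad of unital Poisson algebras -/

namespace LieOperad

/-- The generator of the Lie operad: a binary bracket. -/
inductive Gen : ℕ → Type
  | bracket : Gen 2

variable (k : Type u) [CommRing k]

open OpTerm in
/-- Antisymmetry `b * (12) = -b` and the Jacobi identity
`b ∘₂ b = b ∘₁ b + (b ∘₂ b) * (12)`. -/
inductive Relators : ∀ n, OpTerm k Gen n → OpTerm k Gen n → Prop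
  | antisymm : Relators 2 (act (Equiv.swap 0 1) (gen Gen.bracket)) (smul (-1) (gen Gen.bracket))
  | jacobi : Relators 3 (comp (by omega) 1 (gen Gen.bracket) (gen Gen.bracket))
      (add (comp (by omega) 0 (gen Gen.bracket) (gen Gen.bracket))
        (act (Equiv.swap 0 1) (comp (by omega) 1 (gen Gen.bracket) (gen Gen.bracket))))

/-- The Lie operad. -/
def Lie : SymOperad.{u, u} k := OpTerm.presented (Relators k)

end LieOperad

namespace PoisOperad

/-- The generators of the operad of unital Poisson algebras: the unit `1₀`, the commutative
product `1₂` and the bracket `b`. -/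
inductive Gen : ℕ → Type
  | unit : Gen 0
  | mul : Gen 2
  | bracket : Gen 2

variable (k : Type u) [CommRing k]

open OpTerm in
/-- The relations of unital commutative Poisson algebras. -/
inductive Relators : ∀ n, OpTerm k Gen n → OpTerm k Gen n → Prop
  /-- `1₂ ∘₁ 1₀ = 1` -/
  | unit_mul : Relators 1 (comp (by omega) 0 (gen Gen.mul) (gen Gen.unit)) one
  /-- `1₂ ∘₂ 1₀ = 1` -/
  | mul_unit : Relators 1 (comp (by omega) 1 (gen Gen.mul) (gen Gen.unit)) one
  /-- `b ∘₁ 1₀ = 0` -/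
  | unit_bracket : Relators 1 (comp (by omega) 0 (gen Gen.bracket) (gen Gen.unit)) (zero 1)
  /-- `b ∘₂ 1₀ = 0` -/
  | bracket_unit : Relators 1 (comp (by omega) 1 (gen Gen.bracket) (gen Gen.unit)) (zero 1)
  /-- `1₂ * (12) = 1₂` -/
  | mul_comm : Relators 2 (act (Equiv.swap 0 1) (gen Gen.mul)) (gen Gen.mul)
  /-- `b * (12) = -b` -/
  | antisymm : Relators 2 (act (Equiv.swap 0 1) (gen Gen.bracket)) (smul (-1) (gen Gen.bracket))
  /-- `1₂ ∘₁ 1₂ = 1₂ ∘₂ 1₂` -/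
  | mul_assoc : Relators 3 (comp (by omega) 0 (gen Gen.mul) (gen Gen.mul))
      (comp (by omega) 1 (gen Gen.mul) (gen Gen.mul))
  /-- `b ∘₁ 1₂ = 1₂ ∘₂ b + (1₂ ∘₂ b) * (12)` -/
  | leibniz : Relators 3 (comp (by omega) 0 (gen Gen.bracket) (gen Gen.mul))
      (add (comp (by omega) 1 (gen Gen.mul) (gen Gen.bracket))
        (act (Equiv.swap 0 1) (comp (by omega) 1 (gen Gen.mul) (gen Gen.bracket))))
  /-- `b ∘₂ b = b ∘₁ b + (b ∘₂ b) * (12)` -/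
  | jacobi : Relators 3 (comp (by omega) 1 (gen Gen.bracket) (gen Gen.bracket))
      (add (comp (by omega) 0 (gen Gen.bracket) (gen Gen.bracket))
        (act (Equiv.swap 0 1) (comp (by omega) 1 (gen Gen.bracket) (gen Gen.bracket))))

/-- The operad `Pois` of unital commutative Poisson algebras. -/
def Pois : SymOperad.{u, u} k := OpTerm.presented (Relators k)

/-- The `0`-unit of `Pois`. -/
def unit : (Pois k).obj 0 := OpTerm.cls (Relators k) (OpTerm.gen Gen.unit)

open OpTerm in
theorem collapses {n : ℕ} (a : OpTerm k Gen n) :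
    (Pois k).Collapses (unit k) n (cls (Relators k) a) := by
  induction a with
  | gen x =>
    cases x with
    | unit => exact ⟨1, (one_smul _ _).symm⟩
    | mul =>
      intro i j
      obtain rfl : j = 0 := Fin.ext (by have := j.2; simp)
      refine ⟨1, ?_⟩
      have key : (Pois k).comp (m := 2) (n := 0) (r := 1) rfl i (cls (Relators k) (gen Gen.mul)) (unit k) =
          (Pois k).one := by
        fin_cases i
        · exact cls_eq _ (Rel.of Relators.unit_mul)
        · exact cls_eq _ (Rel.of Relators.mul_unit)
      rw [key, (Pois k).one_comp, one_smul]
    | bracket =>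
      intro i j
      obtain rfl : j = 0 := Fin.ext (by have := j.2; simp)
      refine ⟨0, ?_⟩
      have key : (Pois k).comp (m := 2) (n := 0) (r := 1) rfl i (cls (Relators k) (gen Gen.bracket)) (unit k) = 0 := by
        fin_cases i
        · exact cls_eq _ (Rel.of Relators.unit_bracket)
        · exact cls_eq _ (Rel.of Relators.bracket_unit)
      rw [key, map_zero, LinearMap.zero_apply, zero_smul]
  | one =>
    intro j
    obtain rfl : j = 0 := Fin.ext (by have := j.2; simp)
    exact ⟨1, ((Pois k).one_comp _ _).trans (one_smul _ _).symm⟩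
  | zero n => exact SymOperad.Collapses.zero _ _ n
  | add a b ha hb => exact SymOperad.Collapses.add _ _ ha hb
  | smul c a ha => exact SymOperad.Collapses.smul _ _ c ha
  | act σ a ha => exact SymOperad.Collapses.act _ _ σ ha
  | comp h i a b ha hb => exact SymOperad.Collapses.comp _ _ h i ha hb

theorem unit_span (x : (Pois k).obj 0) : ∃ c : k, x = c • unit k := by
  obtain ⟨a, rfl⟩ := OpTerm.cls_surj (Relators k) x
  exact collapses k a

/-- The quotient of `Pois` by its `K`-th truncation ideal. -/
def PoisTrunc (K : ℕ) : SymOperad.{u, u} k :=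
  (Pois k).quot ((Pois k).truncIdeal (unit k) (unit_span k) K)

end PoisOperad

-- An endomorphism is determined by its values on generators. Here these lie in arities 0 and 2,
-- where the operads are small free modules, so an endomorphism is a handful of coefficients and the
-- relations become equations in `k`. Arity 1 is free on the identity: an invertible element is a
-- unit c times the identity, and conjugation by it multiplies arity n by c^(n-1). Hence the inner
-- automorphisms are exactly the scalings (`range_scale`).
--
-- For `Lie`, the bracket b goes to a multiple c b, and every c is allowed because the relations are
-- homogeneous in b. For `As`, the unit goes to u times itself and the product μ to a μ + b μ^op.
-- The unit law gives u (a + b) = 1 and associativity gives a b = 0 (`mul_eq_zero_of_assoc`), so u a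
-- is idempotent. If 0 and 1 are the only idempotents, μ goes to a multiple of μ or of μ^op. For
-- `Pois`, the generators go to a 1₀, x 1₂ + y b and z 1₂ + t b. The unit relations give a x = 1 and
-- z = 0, commutativity gives 2 y = 0 (`IsPoisson.coeff_eq`), and associativity, in arity 3, gives
-- y² = 0 (`sq_eq_zero_of_assoc`). The hypothesis on `k` removes y; what remains is a unit x and an
-- arbitrary t.
--
-- Generation yields spanning sets in low arity (`BinGen.low`), but linear independence in a
-- presented operad needs a model. The model is the operad of symbols of constant coefficient
-- polydifferential operators: the operator with symbol f sends exponentials with momenta v₁, …, vₙ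
-- to f(v₁, …, vₙ) times the exponential of v₁ + … + vₙ. The product has symbol 1, and the Poisson
-- bracket of the plane has the determinant as its symbol.
--
-- Truncations are treated together with the full operads. The projection is injective in arities
-- below K, and an endomorphism multiplying 1₀ by a unit preserves the truncation ideals. So each
-- classification is proved once, for a surjective morphism that is injective in low arities (the
-- two lemmas `endo_auto_of_hom`). For `As` arity 3 must inject, hence K ≥ 4. For `Pois` with K = 3
-- the equation 2 y = 0 has to suffice, hence the extra hypothesis there.

universe w

namespace SymOperad

variable {k : Type u} [CommRing k]

/-! ## Morphisms of operads -/

/-- A morphism of symmetric operads. -/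
structure Hom (P : SymOperad.{u, v} k) (Q : SymOperad.{u, w} k) where
  app : ∀ n, P.obj n →ₗ[k] Q.obj n
  app_one : app 1 P.one = Q.one
  app_act : ∀ {n : ℕ} (σ : Equiv.Perm (Fin n)) (θ : P.obj n),
    app n (P.act σ θ) = Q.act σ (app n θ)
  app_comp : ∀ {m n r : ℕ} (h : r + 1 = m + n) (i : Fin m) (μ : P.obj m) (ν : P.obj n),
    app r (P.comp h i μ ν) = Q.comp h i (app m μ) (app n ν)

/-- The identity morphism. -/
def Hom.id (P : SymOperad.{u, v} k) : Hom P P where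
  app _ := LinearMap.id
  app_one := rfl
  app_act _ _ := rfl
  app_comp _ _ _ _ := rfl

/-- An endomorphism of the target, composed with a morphism. -/
def EndHom.compHom {P : SymOperad.{u, v} k} {Q : SymOperad.{u, w} k} (Φ : Q.EndHom) (π : Hom P Q) :
    Hom P Q where
  app n := (Φ.app n).comp (π.app n)
  app_one := by simp [π.app_one, Φ.app_one]
  app_act σ θ := by simp [π.app_act, Φ.app_act]
  app_comp h i μ ν := by simp [π.app_comp, Φ.app_comp]

/-- A morphism from an operad to itself is an endomorphism. -/
def Hom.toEnd {P : SymOperad.{u, v} k} (f : Hom P P) : P.EndHom where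
  app := f.app
  app_one := f.app_one
  app_act := f.app_act
  app_comp := f.app_comp

theorem EndHom.ext_app {P : SymOperad.{u, v} k} {Φ Ψ : P.EndHom}
    (h : ∀ n θ, Φ.app n θ = Ψ.app n θ) : Φ = Ψ := by
  apply EndHom.ext
  funext n
  exact LinearMap.ext (h n)

/-- This lets endomorphisms of a quotient be compared on generators of the operad that surjects onto
it. -/
theorem EndHom.eq_of_compHom_eq {P : SymOperad.{u, v} k} {Q : SymOperad.{u, w} k} {Φ Ψ : Q.EndHom}
    {π : Hom P Q} (hπ : ∀ n, Function.Surjective (π.app n))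
    (h : ∀ n θ, (Φ.compHom π).app n θ = (Ψ.compHom π).app n θ) : Φ = Ψ := by
  apply EndHom.ext_app
  intro n θ
  obtain ⟨θ, rfl⟩ := hπ n θ
  exact h n θ

/-! ## Scalings and inner automorphisms -/

theorem scale_app (P : SymOperad.{u, v} k) (c : kˣ) (n : ℕ) (θ : P.obj n) :
    (P.scale c).1.app n θ = ((c ^ ((n : ℤ) - 1) : kˣ) : k) • θ := rfl

theorem scale_app_zero (P : SymOperad.{u, v} k) (c : kˣ) (θ : P.obj 0) :
    (P.scale c).1.app 0 θ = ((c⁻¹ : kˣ) : k) • θ := by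
  rw [scale_app]
  simp

theorem scale_app_two (P : SymOperad.{u, v} k) (c : kˣ) (θ : P.obj 2) :
    (P.scale c).1.app 2 θ = (c : k) • θ := by
  have e : ((2 : ℕ) : ℤ) - 1 = 1 := by norm_num
  rw [scale_app, e, zpow_one]

/-- Each of the n inputs contributes one factor a. Together with the inverse factor at the output
this produces the exponent n - 1 of a scaling. -/
theorem plugAll_smul_one (P : SymOperad.{u, v} k) (a : k) (n : ℕ) (θ : P.obj n) :
    P.plugAll (a • P.one) n θ = a ^ n • θ := by
  have key : ∀ (t : ℕ) (ht : t ≤ n) (h : n + t = n + ∑ _i : Fin t, 1) (θ : P.obj n),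
      P.compAux t (fun _ => 1) (fun _ => a • P.one) ht h θ = a ^ t • θ := by
    intro t
    induction t with
    | zero =>
      intro _ _ θ
      rw [pow_zero, one_smul]
      rfl
    | succ t ih =>
      intro ht h θ
      rw [P.compAux_succ (N' := n) _ _ ht h rfl (by omega) (by simp), map_smul, P.comp_one, ih,
        smul_smul, pow_succ]
  exact key n _ _ θ

/-- If `P 1` is free on the identity, the inner automorphisms are the scalings. -/
theorem range_scale (P : SymOperad.{u, v} k) (h1 : ∀ x : P.obj 1, ∃ c : k, x = c • P.one)
    (h0 : ∀ c : k, c • P.one = 0 → c = 0) : P.scale.range = P.IAut := by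
  have key : ∀ c : kˣ, P.IsInnerBy (P.scale c).1 ((c : k) • P.one) (((c⁻¹ : kˣ) : k) • P.one) := by
    intro c
    refine ⟨?_, ?_, fun n θ => ?_⟩
    · simp [smul_smul, P.one_comp]
    · simp [smul_smul, P.one_comp]
    · rw [scale_app, plugAll_smul_one, map_smul, LinearMap.smul_apply, P.one_comp, smul_smul]
      congr 1
      rw [zpow_sub_one, zpow_natCast]
      push_cast
      rfl
  ext Φ
  constructor
  · rintro ⟨c, rfl⟩
    exact ⟨_, _, key c⟩
  · rintro ⟨x, y, hxy, hyx, hΦ⟩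
    obtain ⟨a, rfl⟩ := h1 x
    obtain ⟨b, rfl⟩ := h1 y
    -- Freeness of arity 1 on the identity turns invertibility of x into invertibility of its
    -- coefficient.
    have hab : a * b = 1 := by
      rw [map_smul, map_smul, LinearMap.smul_apply, P.one_comp, smul_smul] at hxy
      rw [← sub_eq_zero]
      apply h0
      rw [sub_smul, one_smul, mul_comm, hxy, sub_self]
    refine ⟨⟨a, b, hab, by rw [mul_comm, hab]⟩, ?_⟩
    apply Units.ext
    apply EndHom.ext_app
    intro n θ
    rw [hΦ n θ, (key _).2.2 n θ]
    rfl

/-- Scalings are detected by an arity `2` element with trivial annihilator. -/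
theorem scale_injective (P : SymOperad.{u, v} k) (x : P.obj 2) (hx : ∀ c : k, c • x = 0 → c = 0) :
    Function.Injective P.scale := by
  intro c d h
  have e := congrArg (fun Φ : P.AutGroup => Φ.1.app 2 x) h
  simp only [scale_app_two] at e
  apply Units.ext
  rw [← sub_eq_zero]
  apply hx
  rw [sub_smul, sub_eq_zero]
  exact e

/-! ## Quotients -/

/-- The projection onto a quotient operad. -/
def quotMk (P : SymOperad.{u, v} k) (I : P.OpIdeal) : Hom P (P.quot I) where
  app n := (I.sub n).mkQ
  app_one := rfl
  app_act _ _ := rfl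
  app_comp _ _ _ _ := rfl

theorem quotMk_surjective (P : SymOperad.{u, v} k) (I : P.OpIdeal) (n : ℕ) :
    Function.Surjective ((P.quotMk I).app n) :=
  Submodule.mkQ_surjective _

/-- The truncation ideal vanishes below arity K, so equations between coefficients found in those
arities of the quotient already hold in `P`. -/
theorem quotMk_injective (P : SymOperad.{u, v} k) (u : P.obj 0)
    (hu : ∀ x : P.obj 0, ∃ c : k, x = c • u) {K n : ℕ} (hn : n < K) :
    Function.Injective ((P.quotMk (P.truncIdeal u hu K)).app n) := by
  rw [← LinearMap.ker_eq_bot]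
  refine (Submodule.ker_mkQ _).trans ?_
  rw [eq_bot_iff]
  intro θ hθ
  exact (P.mem_truncSub_of_lt u hn θ).mp hθ

/-- An endomorphism preserving an ideal induces an endomorphism of the quotient. -/
def quotEnd (P : SymOperad.{u, v} k) (I : P.OpIdeal) (Φ : P.EndHom)
    (h : ∀ n θ, θ ∈ I.sub n → Φ.app n θ ∈ I.sub n) : (P.quot I).EndHom where
  app n := (I.sub n).mapQ (I.sub n) (Φ.app n) (h n)
  app_one := congrArg Submodule.Quotient.mk Φ.app_one
  app_act {n} σ θ := by
    obtain ⟨θ, rfl⟩ := Submodule.Quotient.mk_surjective _ θ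
    exact congrArg Submodule.Quotient.mk (Φ.app_act σ θ)
  app_comp {m n r} h i μ ν := by
    obtain ⟨μ, rfl⟩ := Submodule.Quotient.mk_surjective _ μ
    obtain ⟨ν, rfl⟩ := Submodule.Quotient.mk_surjective _ ν
    exact congrArg Submodule.Quotient.mk (Φ.app_comp h i μ ν)

/-- By the recursive description of the ideal it is enough to plug in `u`. Up to the factor c this
commutes with Φ, and the factor can be cancelled because c is a unit. -/
theorem EndHom.app_mem_truncSub {P : SymOperad.{u, v} k} {u : P.obj 0} (Φ : P.EndHom) (c : kˣ)
    (hc : Φ.app 0 u = (c : k) • u) (K n : ℕ) (θ : P.obj n) (hθ : θ ∈ P.truncSub u K n) :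
    Φ.app n θ ∈ P.truncSub u K n := by
  rcases Nat.eq_zero_or_pos K with rfl | hK
  · simp [truncSub_zero]
  induction n with
  | zero =>
    rw [P.mem_truncSub_of_lt u hK] at hθ ⊢
    simp [hθ]
  | succ n ih =>
    rcases Nat.lt_or_ge (n + 1) K with hn | hn
    · rw [P.mem_truncSub_of_lt u hn] at hθ ⊢
      simp [hθ]
    · rw [P.mem_truncSub_succ u hn] at hθ ⊢
      intro i
      have h1 := ih _ (hθ i)
      rw [Φ.app_comp, hc, map_smul] at h1
      have h2 := Submodule.smul_mem _ ((c⁻¹ : kˣ) : k) h1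
      rwa [smul_smul, Units.inv_mul, one_smul] at h2

/-- An endomorphism that rescales the `0`-unit by a unit descends to the truncations. -/
theorem exists_truncEnd {P : SymOperad.{u, v} k} {u : P.obj 0}
    (hu : ∀ x : P.obj 0, ∃ c : k, x = c • u) (K : ℕ) (Φ : P.EndHom) (c : kˣ)
    (hc : Φ.app 0 u = (c : k) • u) :
    ∃ Ψ : (P.quot (P.truncIdeal u hu K)).EndHom, ∀ n θ,
      Ψ.app n ((P.quotMk (P.truncIdeal u hu K)).app n θ) =
        (P.quotMk (P.truncIdeal u hu K)).app n (Φ.app n θ) :=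
  ⟨P.quotEnd _ Φ (fun n θ hθ => Φ.app_mem_truncSub c hc K n θ hθ), fun _ _ => rfl⟩

/-! ## Low arities of operads generated by binary operations -/

/-- The elements obtained from the identity and a set of binary operations. -/
inductive BinGen (P : SymOperad.{u, v} k) (S : Set (P.obj 2)) : ∀ n, P.obj n → Prop
  | one : BinGen P S 1 P.one
  | gen (x : P.obj 2) : x ∈ S → BinGen P S 2 x
  | zero (n : ℕ) : BinGen P S n 0
  | add {n : ℕ} (x y : P.obj n) : BinGen P S n x → BinGen P S n y → BinGen P S n (x + y)
  | smul {n : ℕ} (c : k) (x : P.obj n) : BinGen P S n x → BinGen P S n (c • x)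
  | act {n : ℕ} (σ : Equiv.Perm (Fin n)) (x : P.obj n) : BinGen P S n x → BinGen P S n (P.act σ x)
  | comp {m n r : ℕ} (h : r + 1 = m + n) (i : Fin m) (x : P.obj m) (y : P.obj n) :
      BinGen P S m x → BinGen P S n y → BinGen P S r (P.comp h i x y)

/-- Being `0` in arity `0`, a multiple of the identity in arity `1`, an element of `M` in arity
`2`. -/
def Low (P : SymOperad.{u, v} k) (M : Submodule k (P.obj 2)) : ∀ n, P.obj n → Prop
  | 0, x => x = 0
  | 1, x => ∃ c : k, x = c • P.one
  | 2, x => x ∈ M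
  | _ + 3, _ => True

theorem Low.zero (P : SymOperad.{u, v} k) (M : Submodule k (P.obj 2)) (n : ℕ) :
    P.Low M n 0 := by
  match n with
  | 0 => exact rfl
  | 1 => exact ⟨0, (zero_smul _ _).symm⟩
  | 2 => exact M.zero_mem
  | _ + 3 => trivial

theorem Low.smul (P : SymOperad.{u, v} k) (M : Submodule k (P.obj 2)) (n : ℕ) (c : k) (x : P.obj n)
    (hx : P.Low M n x) : P.Low M n (c • x) := by
  match n, x, hx with
  | 0, x, hx => exact (congrArg (c • ·) hx).trans (smul_zero c)
  | 1, x, ⟨d, hd⟩ => exact ⟨c * d, by rw [hd, smul_smul]⟩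
  | 2, x, hx => exact M.smul_mem c hx
  | _ + 3, _, _ => trivial

/-- Nothing new can appear in low arity. Without generators of arity 0, a composite of arity at most
2 is zero or has a multiple of the identity as one of its factors; the only other operation in arity
2 is the swap, which preserves `M`. -/
theorem BinGen.low {P : SymOperad.{u, v} k} {S : Set (P.obj 2)} (M : Submodule k (P.obj 2))
    (hS : S ⊆ M) (hM : ∀ x ∈ M, P.act (Equiv.swap 0 1) x ∈ M) {n : ℕ} {x : P.obj n}
    (hx : P.BinGen S n x) : P.Low M n x := by
  induction hx with
  | one => exact ⟨1, (one_smul _ _).symm⟩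
  | gen x hx => exact hS hx
  | zero n => exact Low.zero P M n
  | @add n x y _ _ hx hy =>
    match n, x, y, hx, hy with
    | 0, x, y, hx, hy => exact (congrArg₂ (· + ·) hx hy).trans (add_zero 0)
    | 1, x, y, ⟨c, hc⟩, ⟨d, hd⟩ => exact ⟨c + d, by rw [hc, hd, add_smul]⟩
    | 2, x, y, hx, hy => exact M.add_mem hx hy
    | _ + 3, _, _, _, _ => trivial
  | smul c x _ hx => exact Low.smul P M _ c x hx
  | @act n σ x _ hx =>
    match n, σ, x, hx with
    | 0, σ, x, hx => exact (congrArg (P.act σ) hx).trans (map_zero _)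
    | 1, σ, x, hx =>
      obtain rfl : σ = 1 := Subsingleton.elim _ _
      rwa [P.act_one]
    | 2, σ, x, hx =>
      have h2 : ∀ σ : Equiv.Perm (Fin 2), σ = 1 ∨ σ = Equiv.swap 0 1 := by decide
      rcases h2 σ with rfl | rfl
      · rwa [P.act_one]
      · exact hM x hx
    | _ + 3, _, _, _ => trivial
  | @comp m n r h i x y _ _ hx hy =>
    match n, y, hy with
    | 0, y, hy =>
      obtain rfl : y = 0 := hy
      rw [map_zero]
      exact Low.zero P M r
    | 1, y, ⟨c, hc⟩ =>
      obtain rfl : r = m := by omega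
      rw [hc, map_smul, P.comp_one]
      exact Low.smul P M _ c x hx
    | n + 2, y, hy =>
      match m, i, x, hx with
      | 0, i, _, _ => exact i.elim0
      | 1, i, x, ⟨c, hc⟩ =>
        obtain rfl : r = n + 2 := by omega
        obtain rfl : i = 0 := Subsingleton.elim _ _
        rw [hc, map_smul, LinearMap.smul_apply, P.one_comp]
        exact Low.smul P M _ c y hy
      -- Two operations of arity at least 2 compose to arity at least 3, where `Low` claims nothing.
      | m + 2, i, x, hx =>
        obtain rfl : r = m + n + 3 := by omega
        trivial

/-- Plugging in a `0`-unit preserves `BinGen` in positive arity. -/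
theorem BinGen.comp_unit {P : SymOperad.{u, v} k} {S : Set (P.obj 2)} {M : Submodule k (P.obj 2)}
    (hS : S ⊆ M) (hM : ∀ x ∈ M, P.act (Equiv.swap 0 1) x ∈ M) (u : P.obj 0)
    (hu : ∀ x ∈ S, ∀ i : Fin 2, ∃ c : k, P.comp (m := 2) (n := 0) (r := 1) rfl i x u = c • P.one)
    {N : ℕ} {x : P.obj N} (hx : P.BinGen S N x) :
    ∀ {r : ℕ} (h : r + 1 = N + 0) (_ : 0 < r) (i : Fin N), P.BinGen S r (P.comp h i x u) := by
  induction hx with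
  | one => intros; omega
  | gen x hx =>
    intro r h hr i
    obtain rfl : r = 1 := by omega
    obtain ⟨c, hc⟩ := hu x hx i
    rw [hc]
    exact .smul _ _ .one
  | zero n =>
    intro r h hr i
    rw [map_zero, LinearMap.zero_apply]
    exact .zero _
  | add x y _ _ hx hy =>
    intro r h hr i
    rw [map_add, LinearMap.add_apply]
    exact .add _ _ (hx h hr i) (hy h hr i)
  | smul c x _ hx =>
    intro r h hr i
    rw [map_smul, LinearMap.smul_apply]
    exact .smul _ _ (hx h hr i)
  | act σ x _ hx =>
    intro r h hr i
    rw [P.act_comp]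
    exact .act _ _ (hx h hr _)
  | @comp m n N h' i x y hx' hy' hx hy =>
    intro r h hr p
    obtain rfl : N = r + 1 := by omega
    refine P.comp_comp_unit u h' i p x y (C := fun z => P.BinGen S r z) ?_ ?_
    · rintro n' rfl hr' j
      rcases Nat.eq_zero_or_pos n' with rfl | hn'
      · obtain ⟨c, rfl⟩ : ∃ c : k, y = c • P.one := hy'.low M hS hM
        obtain rfl : j = 0 := Fin.ext (by have := j.2; simp)
        rw [map_smul, LinearMap.smul_apply, P.one_comp, map_smul]
        exact .smul _ _ (hx hr' hr i)
      · exact .comp _ _ _ _ hx' (hy _ hn' j)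
    -- The arity `m'` left after plugging into `x` is positive, since it still has the input `i'`.
    · rintro m' rfl hr' q i'
      exact .comp _ _ _ _ (hx _ (by have := i'.2; omega) q) hy'

end SymOperad

/-! ## The universal property of presented operads -/

namespace OpTerm

open SymOperad

variable {k : Type u} [CommRing k] {X : ℕ → Type}

/-- Evaluation of expressions in an operad. -/
def eval (Q : SymOperad.{u, w} k) (g : ∀ n, X n → Q.obj n) : ∀ {n : ℕ}, OpTerm k X n → Q.obj n
  | _, gen x => g _ x
  | _, one => Q.one
  | _, zero _ => 0
  | _, add a b => eval Q g a + eval Q g b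
  | _, smul c a => c • eval Q g a
  | _, act σ a => Q.act σ (eval Q g a)
  | _, comp h i a b => Q.comp h i (eval Q g a) (eval Q g b)

variable {R : ∀ n, OpTerm k X n → OpTerm k X n → Prop}

theorem eval_eq_of_rel (Q : SymOperad.{u, w} k) (g : ∀ n, X n → Q.obj n)
    (hR : ∀ n a b, R n a b → eval Q g a = eval Q g b) {n : ℕ} {a b : OpTerm k X n}
    (h : Rel R a b) : eval Q g a = eval Q g b := by
  induction h with
  | of h => exact hR _ _ _ h
  | refl => rfl
  | symm _ ih => exact ih.symm
  | trans _ _ ih ih' => exact ih.trans ih'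
  | add_congr _ _ ih ih' => simp only [eval, ih, ih']
  | smul_congr _ _ ih => simp only [eval, ih]
  | act_congr _ _ ih => simp only [eval, ih]
  | comp_congr _ _ _ _ ih ih' => simp only [eval, ih, ih']
  | add_assoc => exact _root_.add_assoc _ _ _
  | add_comm => exact _root_.add_comm _ _
  | zero_add => exact _root_.zero_add _
  | zero_smul => exact _root_.zero_smul _ _
  | one_smul => exact _root_.one_smul _ _
  | mul_smul => exact SemigroupAction.mul_smul _ _ _
  | add_smul => exact _root_.add_smul _ _ _
  | smul_add => exact _root_.smul_add _ _ _
  | act_add => exact map_add _ _ _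
  | act_smul => exact map_smul _ _ _
  | comp_add => exact map_add _ _ _
  | comp_smul => exact map_smul _ _ _
  | add_comp => exact LinearMap.map_add₂ _ _ _ _
  | smul_comp => exact LinearMap.map_smul₂ _ _ _ _
  | act_one => exact Q.act_one _
  | act_mul => exact Q.act_mul _ _ _
  | comp_one => exact Q.comp_one _ _ _
  | one_comp => exact Q.one_comp _ _
  | assoc h₁ h₂ h₃ h₄ i j q hq => exact Q.assoc h₁ h₂ h₃ h₄ i j q hq _ _ _
  | comm h₁ h₂ h₃ h₄ i c hic q hq q' hq' => exact Q.comm h₁ h₂ h₃ h₄ i c hic q hq q' hq' _ _ _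
  | comp_act => exact Q.comp_act _ _ _ _ _
  | act_comp => exact Q.act_comp _ _ _ _ _

/-- The morphism out of a presented operad given by images of the generators that satisfy the
relations. -/
def lift (Q : SymOperad.{u, w} k) (g : ∀ n, X n → Q.obj n)
    (hR : ∀ n a b, R n a b → eval Q g a = eval Q g b) : Hom (presented R) Q where
  app n :=
    { toFun := Quotient.lift (eval Q g) (fun _ _ h => eval_eq_of_rel Q g hR h)
      map_add' := by
        rintro ⟨a⟩ ⟨b⟩
        rfl
      map_smul' := by
        rintro c ⟨a⟩
        rfl }
  app_one := rfl
  app_act := by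
    rintro n σ ⟨a⟩
    rfl
  app_comp := by
    rintro m n r h i ⟨a⟩ ⟨b⟩
    rfl

/-- A generator, as an element of the presented operad. -/
def genCls (R : ∀ n, OpTerm k X n → OpTerm k X n → Prop) {n : ℕ} (x : X n) : (presented R).obj n :=
  cls R (gen x)

/-- Evaluation in the presented operad is the class. -/
theorem eval_genCls {n : ℕ} (a : OpTerm k X n) :
    eval (presented R) (fun _ x => genCls R x) a = cls R a := by
  induction a with
  | gen => rfl
  | one => rfl
  | zero => rfl
  | add a b ha hb => simp only [eval, ha, hb]; rfl
  | smul c a ha => simp only [eval, ha]; rfl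
  | act σ a ha => simp only [eval, ha]; rfl
  | comp h i a b ha hb => simp only [eval, ha, hb]; rfl

/-- The relations hold in the presented operad. -/
theorem eval_genCls_eq {n : ℕ} {a b : OpTerm k X n} (h : R n a b) :
    eval (presented R) (fun _ x => genCls R x) a = eval (presented R) (fun _ x => genCls R x) b := by
  rw [eval_genCls, eval_genCls]
  exact cls_eq R (.of h)

/-- Induction principle for presented operads. -/
theorem presented_induction {C : ∀ n, (presented R).obj n → Prop}
    (gen : ∀ {n : ℕ} (x : X n), C n (genCls R x)) (one : C 1 (presented R).one)
    (zero : ∀ n, C n 0)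
    (add : ∀ {n : ℕ} (x y : (presented R).obj n), C n x → C n y → C n (x + y))
    (smul : ∀ {n : ℕ} (c : k) (x : (presented R).obj n), C n x → C n (c • x))
    (act : ∀ {n : ℕ} (σ : Equiv.Perm (Fin n)) (x : (presented R).obj n), C n x →
      C n ((presented R).act σ x))
    (comp : ∀ {m n r : ℕ} (h : r + 1 = m + n) (i : Fin m) (x : (presented R).obj m)
      (y : (presented R).obj n), C m x → C n y → C r ((presented R).comp h i x y))
    {n : ℕ} (x : (presented R).obj n) : C n x := by
  obtain ⟨a, rfl⟩ := cls_surj R x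
  induction a with
  | gen x => exact gen x
  | one => exact one
  | zero n => exact zero n
  | add a b ha hb => exact add _ _ ha hb
  | smul c a ha => exact smul c _ ha
  | act σ a ha => exact act σ _ ha
  | comp h i a b ha hb => exact comp h i _ _ ha hb

theorem hom_ext {Q : SymOperad.{u, w} k} {f g : Hom (presented R) Q}
    (h : ∀ n (x : X n), f.app n (genCls R x) = g.app n (genCls R x)) (n : ℕ)
    (x : (presented R).obj n) : f.app n x = g.app n x := by
  induction x using presented_induction with
  | gen x => exact h _ x
  | one => rw [f.app_one, g.app_one]
  | zero n => rw [map_zero, map_zero]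
  | add x y hx hy => rw [map_add, map_add, hx, hy]
  | smul c x hx => rw [map_smul, map_smul, hx]
  | act σ x hx => rw [f.app_act, g.app_act, hx]
  | comp h i x y hx hy => rw [f.app_comp, g.app_comp, hx, hy]

end OpTerm

/-! ## The operad of symbols

The symbols of polydifferential operators with constant coefficients form an operad, in which the
commutative product is the constant `1` and a constant Poisson bracket is a bilinear form. -/

namespace SymbolOperad

/-- The input of `μ` that an input of `μ ∘ᵢ ν` belongs to. -/
def col {m n r : ℕ} (h : r + 1 = m + n) (i : Fin m) (p : Fin r) : Fin m :=
  if _ : p.1 < i.1 then ⟨p.1, by have := i.2; omega⟩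
  else if _ : p.1 < i.1 + n then i else ⟨p.1 + 1 - n, by have := p.2; omega⟩

/-- The inclusion of the inputs of `ν` into those of `μ ∘ᵢ ν`. -/
def emb {m n r : ℕ} (h : r + 1 = m + n) (i : Fin m) (t : Fin n) : Fin r :=
  ⟨i.1 + t.1, by have := i.2; have := t.2; omega⟩

theorem col_val {m n r : ℕ} (h : r + 1 = m + n) (i : Fin m) (p : Fin r) :
    (col h i p).1 = if p.1 < i.1 then p.1 else if p.1 < i.1 + n then i.1 else p.1 + 1 - n := by
  unfold col
  split_ifs <;> rfl

theorem emb_val {m n r : ℕ} (h : r + 1 = m + n) (i : Fin m) (t : Fin n) :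
    (emb h i t).1 = i.1 + t.1 := rfl

/-- A block permutation carries the block over j to the block over φ j. This and `permComp_emb` give
the equivariance of the composition of symbols. -/
theorem col_permComp {m n r : ℕ} (h : r + 1 = m + n) (φ : Equiv.Perm (Fin m)) (i : Fin m)
    (σ : Equiv.Perm (Fin n)) (p : Fin r) :
    col h (φ i) (permComp h φ i σ p) = φ (col h i p) := by
  apply Fin.ext
  rcases ins_cases h i p with ⟨j, hj, hp⟩ | ⟨t, hp⟩
  · have hj' : j.1 ≠ i.1 := fun e => hj (Fin.ext e)
    have hφ : (φ j).1 ≠ (φ i).1 := fun e => hj (φ.injective (Fin.ext e))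
    have hc : col h i p = j := by
      apply Fin.ext
      rw [col_val]
      split_ifs at hp ⊢ <;> omega
    rw [col_val, permComp_inl h φ i σ p j hj hp, hc]
    split_ifs <;> omega
  · have ht := t.2
    have hc : col h i p = i := by
      apply Fin.ext
      rw [col_val]
      split_ifs <;> omega
    rw [col_val, permComp_inr h φ i σ p t hp, hc]
    have := (σ t).2
    split_ifs <;> omega

theorem permComp_emb {m n r : ℕ} (h : r + 1 = m + n) (φ : Equiv.Perm (Fin m)) (i : Fin m)
    (σ : Equiv.Perm (Fin n)) (t : Fin n) :
    permComp h φ i σ (emb h i t) = emb h (φ i) (σ t) :=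
  Fin.ext (permComp_inr h φ i σ _ t rfl)

section Push

variable {V : Type v} [AddCommMonoid V]

/-- Summation along the fibres of a map. -/
def push {m r : ℕ} (c : Fin r → Fin m) (v : Fin r → V) (j : Fin m) : V :=
  ∑ p, if c p = j then v p else 0

/-- Momenta may be summed in stages; this is what makes nested compositions of symbols agree. -/
theorem push_push {l m r : ℕ} (c : Fin m → Fin l) (d : Fin r → Fin m) (v : Fin r → V) :
    push c (push d v) = push (c ∘ d) v := by
  funext j
  unfold push
  have : ∀ q, (if c q = j then ∑ p, (if d p = q then v p else 0) else 0) =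
      ∑ p, if d p = q then (if c q = j then v p else 0) else 0 := by
    intro q
    split_ifs <;> simp
  simp only [this]
  rw [Finset.sum_comm]
  simp

theorem push_apply_of_unique {m r : ℕ} (c : Fin r → Fin m) (v : Fin r → V) (j : Fin m) (q : Fin r)
    (h : ∀ p, c p = j ↔ p = q) : push c v j = v q := by
  simp [push, h]

theorem push_equiv {m r : ℕ} (c : Fin r → Fin m) (σ : Equiv.Perm (Fin r)) (v : Fin r → V) :
    push c (v ∘ σ.symm) = push (c ∘ σ) v := by
  funext j
  unfold push
  rw [← Equiv.sum_comp σ]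
  simp

theorem equiv_push {m r : ℕ} (c : Fin r → Fin m) (φ : Equiv.Perm (Fin m)) (v : Fin r → V) :
    push c v ∘ φ.symm = push (φ ∘ c) v := by
  funext j
  simp [push, Equiv.eq_symm_apply]

/-- Summation along fibres commutes with restriction. -/
theorem push_apply_of_pullback {m r n b : ℕ} (c : Fin r → Fin m) (c' : Fin b → Fin n)
    (e' : Fin b → Fin r) (he' : Function.Injective e') (v : Fin r → V) (j : Fin m) (y : Fin n)
    (h : ∀ p, c p = j ↔ ∃ t, e' t = p ∧ c' t = y) : push c v j = push c' (v ∘ e') y := by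
  unfold push
  rw [← Finset.sum_filter, ← Finset.sum_filter]
  symm
  apply Finset.sum_bij (fun t _ => e' t)
  · intro t ht
    simp only [Finset.mem_filter, Finset.mem_univ, true_and] at ht ⊢
    exact (h _).mpr ⟨t, rfl, ht⟩
  · intro _ _ _ _ e
    exact he' e
  · intro p hp
    simp only [Finset.mem_filter, Finset.mem_univ, true_and] at hp
    obtain ⟨t, ht, hy⟩ := (h p).mp hp
    exact ⟨t, by simpa using hy, ht⟩
  · intros
    rfl

end Push

variable (k : Type u) [CommRing k] (V : Type v) [AddCommMonoid V]

/-- Partial composition of symbols. -/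
def comp {m n r : ℕ} (h : r + 1 = m + n) (i : Fin m) :
    ((Fin m → V) → k) →ₗ[k] ((Fin n → V) → k) →ₗ[k] ((Fin r → V) → k) :=
  LinearMap.mk₂ k (fun f g v => f (push (col h i) v) * g (v ∘ emb h i))
    (fun _ _ _ => funext fun _ => add_mul _ _ _)
    (fun _ _ _ => funext fun _ => mul_assoc _ _ _)
    (fun _ _ _ => funext fun _ => mul_add _ _ _)
    (fun _ _ _ => funext fun _ => mul_left_comm _ _ _)

theorem comp_apply {m n r : ℕ} (h : r + 1 = m + n) (i : Fin m) (f : (Fin m → V) → k)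
    (g : (Fin n → V) → k) (v : Fin r → V) :
    comp k V h i f g v = f (push (col h i) v) * g (v ∘ emb h i) := rfl

/-- The operad of symbols: arity `n` operations are functions of `n` momenta in `V`, and the
momentum of an input of `μ` in `μ ∘ᵢ ν` is the sum of the momenta of the inputs over it. -/
def symbolOperad : SymOperad.{u, max u v} k where
  obj n := (Fin n → V) → k
  act σ := LinearMap.funLeft k k (fun v => v ∘ σ.symm)
  one := fun _ => 1
  comp h i := comp k V h i
  act_one _ := rfl
  act_mul _ _ _ := rfl
  comp_one {n} h i θ := by
    funext v
    rw [comp_apply, mul_one]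
    congr 1
    funext j
    apply push_apply_of_unique
    intro p
    rw [Fin.ext_iff, Fin.ext_iff, col_val]
    split_ifs <;> omega
  one_comp {n} h θ := by
    funext v
    rw [comp_apply, one_mul]
    congr 1
    funext t
    exact congrArg v (Fin.ext (by simp [emb_val]))
  assoc {l m n a b s} h₁ h₂ h₃ h₄ i j q hq α β γ := by
    funext v
    simp only [comp_apply]
    rw [mul_assoc, push_push]
    have hi := i.2
    have hj := j.2
    have e1 : col h₁ i ∘ col h₂ q = col h₄ i := by
      funext p
      apply Fin.ext
      simp only [Function.comp_apply, col_val]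
      split_ifs <;> omega
    -- The momenta seen by `β`: the fibre over an input of `β` lies inside the block of β ∘ⱼ γ, so
    -- summing over it commutes with restricting to that block.
    have e2 : push (col h₂ q) v ∘ emb h₁ i = push (col h₃ j) (v ∘ emb h₄ i) := by
      funext y
      refine push_apply_of_pullback _ _ _ ?_ v _ y ?_
      · intro x y hxy
        have := congrArg Fin.val hxy
        simp only [emb_val] at this
        exact Fin.ext (by omega)
      · intro p
        have hy := y.2
        have hp := p.2
        constructor
        · intro e
          have e := congrArg Fin.val e
          rw [col_val, emb_val] at e
          have hip : i.1 ≤ p.1 := by split_ifs at e <;> omega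
          have hpb : p.1 - i.1 < b := by split_ifs at e <;> omega
          refine ⟨⟨p.1 - i.1, hpb⟩, Fin.ext ?_, Fin.ext ?_⟩
          · rw [emb_val]
            exact Nat.add_sub_cancel' hip
          · rw [col_val]
            dsimp only
            split_ifs at e ⊢ <;> omega
        · rintro ⟨t, rfl, rfl⟩
          have ht := t.2
          apply Fin.ext
          rw [col_val, emb_val, emb_val, col_val]
          split_ifs <;> omega
    have e3 : emb h₄ i ∘ emb h₃ j = emb h₂ q := by
      funext t
      apply Fin.ext
      simp only [Function.comp_apply, emb_val]
      omega
    rw [e1, e2, Function.comp_assoc, e3]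
  comm {l m n a b s} h₁ h₂ h₃ h₄ i c hic q hq q' hq' α β γ := by
    funext v
    simp only [comp_apply]
    rw [push_push, push_push, mul_right_comm]
    have hi := i.2
    have hc := c.2
    have e1 : col h₁ i ∘ col h₂ q = col h₃ c ∘ col h₄ q' := by
      funext p
      apply Fin.ext
      simp only [Function.comp_apply, col_val]
      split_ifs <;> omega
    -- As `i < c`, the block of `β` is disjoint from the place where `γ` is inserted. The fibres
    -- over it are single points and no momenta are added; `e3` is the same for the block of `γ`.
    have e2 : push (col h₂ q) v ∘ emb h₁ i = v ∘ emb h₄ q' := by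
      funext y
      apply push_apply_of_unique
      intro p
      have hy := y.2
      simp only [Fin.ext_iff, col_val, emb_val]
      split_ifs <;> omega
    have e3 : push (col h₄ q') v ∘ emb h₃ c = v ∘ emb h₂ q := by
      funext y
      apply push_apply_of_unique
      intro p
      have hy := y.2
      simp only [Fin.ext_iff, col_val, emb_val]
      split_ifs <;> omega
    rw [e1, e2, e3]
  comp_act {m n r} h i μ ν σ := by
    funext v
    simp only [comp_apply, LinearMap.funLeft_apply]
    rw [push_equiv]
    have e1 : col h i ∘ permComp h 1 i σ = col h i := funext fun p => col_permComp h 1 i σ p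
    have e2 : (permComp h 1 i σ).symm ∘ emb h i = emb h i ∘ σ.symm := by
      funext t
      rw [Function.comp_apply, Equiv.symm_apply_eq]
      simp [permComp_emb]
    rw [e1, Function.comp_assoc, Function.comp_assoc, e2]
  act_comp {m n r} h i μ ν φ := by
    funext v
    simp only [comp_apply, LinearMap.funLeft_apply]
    rw [push_equiv, equiv_push]
    have e1 : col h (φ i) ∘ permComp h φ i 1 = φ ∘ col h i :=
      funext fun p => col_permComp h φ i 1 p
    have e2 : (permComp h φ i 1).symm ∘ emb h (φ i) = emb h i := by
      funext t
      rw [Function.comp_apply, Equiv.symm_apply_eq]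
      simp [permComp_emb]
    rw [e1, Function.comp_assoc, e2]

theorem symbolOperad_act {n : ℕ} (σ : Equiv.Perm (Fin n)) (f : (Fin n → V) → k) :
    (symbolOperad k V).act σ f = fun v => f (v ∘ σ.symm) := rfl

/-- The symbol of the Poisson bracket on the plane. -/
def bracket : (symbolOperad k (k × k)).obj 2 := fun v => (v 0).1 * (v 1).2 - (v 1).1 * (v 0).2

/-- The symbol of the pointwise product. -/
def mul : (symbolOperad k (k × k)).obj 2 := fun _ => 1

/-- The symbol of the constant function `1`. -/
def unit : (symbolOperad k (k × k)).obj 0 := fun _ => 1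

theorem bracket_antisymm : (symbolOperad k (k × k)).act (Equiv.swap 0 1) (bracket k) =
    (-1 : k) • bracket k := by
  refine (symbolOperad_act k (k × k) _ _).trans (funext fun v => ?_)
  change bracket k _ = -1 * bracket k v
  simp [bracket]

/-- Writing ij for the bracket of the momenta i and j, the identity is (01 + 02) 12 = (02 + 12) 01 +
(10 + 12) 02. It follows from biadditivity and antisymmetry alone. -/
theorem jacobi : (symbolOperad k (k × k)).comp (m := 2) (n := 2) (r := 3) rfl 1 (bracket k) (bracket k) =
    (symbolOperad k (k × k)).comp (m := 2) (n := 2) (r := 3) rfl 0 (bracket k) (bracket k) +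
      (symbolOperad k (k × k)).act (Equiv.swap 0 1)
        ((symbolOperad k (k × k)).comp (m := 2) (n := 2) (r := 3) rfl 1 (bracket k) (bracket k)) := by
  funext v
  change bracket k _ * bracket k _ = bracket k _ * bracket k _ + bracket k _ * bracket k _
  simp [bracket, push, col, emb, Fin.sum_univ_three, Equiv.swap_apply_def]
  ring

/-- The momentum of a product is the sum of the momenta of its factors, so the Leibniz rule is
additivity of the bracket in its first argument. -/
theorem leibniz : (symbolOperad k (k × k)).comp (m := 2) (n := 2) (r := 3) rfl 0 (bracket k) (mul k) =
    (symbolOperad k (k × k)).comp (m := 2) (n := 2) (r := 3) rfl 1 (mul k) (bracket k) +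
      (symbolOperad k (k × k)).act (Equiv.swap 0 1)
        ((symbolOperad k (k × k)).comp (m := 2) (n := 2) (r := 3) rfl 1 (mul k) (bracket k)) := by
  funext v
  change bracket k _ * mul k _ = mul k _ * bracket k _ + mul k _ * bracket k _
  simp [bracket, mul, push, col, emb, Fin.sum_univ_three, Equiv.swap_apply_def]
  ring

/-- The input filled by the constant 1 receives the empty sum of momenta, which is 0, and the
bracket of 0 with anything vanishes. -/
theorem bracket_unit (i : Fin 2) :
    (symbolOperad k (k × k)).comp (m := 2) (n := 0) (r := 1) rfl i (bracket k) (unit k) = 0 := by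
  funext v
  change bracket k _ * unit k _ = 0
  fin_cases i <;> simp [bracket, unit, push, col]

theorem smul_bracket_eq_zero (c d : k) (h : c • mul k + d • bracket k = 0) : c = 0 ∧ d = 0 := by
  have h1 : ∀ v : Fin 2 → k × k, c * 1 + d * ((v 0).1 * (v 1).2 - (v 1).1 * (v 0).2) = 0 :=
    fun v => congrFun h v
  have h0 := h1 0
  have h2 := h1 ![(1, 0), (0, 1)]
  simp at h0 h2
  simp_all

/-- The terms in x² and x y agree in the two composites. With ij the bracket of the momenta i and j,
their difference is y² · 02 · (01 - 12), so it suffices to find momenta where the factor after y² is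
a unit. -/
theorem sq_eq_zero_of_assoc (x y : k)
    (h : (symbolOperad k (k × k)).comp (m := 2) (n := 2) (r := 3) rfl 0 (x • mul k + y • bracket k)
        (x • mul k + y • bracket k) =
      (symbolOperad k (k × k)).comp (m := 2) (n := 2) (r := 3) rfl 1 (x • mul k + y • bracket k)
        (x • mul k + y • bracket k)) : y * y = 0 := by
  -- At the momenta e₁, e₁, e₂ the two sides are (x + 2 y) x and (x + y)².
  have h1 : (x * 1 + y * bracket k _) * (x * 1 + y * bracket k _) =
      (x * 1 + y * bracket k _) * (x * 1 + y * bracket k _) :=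
    congrFun h ![(1, 0), (1, 0), (0, 1)]
  simp [bracket, push, col, emb, Fin.sum_univ_three] at h1
  linear_combination -h1

end SymbolOperad

/-! ### The Lie operad -/

namespace LieOperad

open SymOperad OpTerm

variable (k : Type u) [CommRing k]

/-- The Lie bracket. -/
def br : (Lie k).obj 2 := genCls (Relators k) Gen.bracket

theorem br_antisymm : (Lie k).act (Equiv.swap 0 1) (br k) = (-1 : k) • br k :=
  eval_genCls_eq (R := Relators k) Relators.antisymm

theorem br_jacobi : (Lie k).comp (m := 2) (n := 2) (r := 3) rfl 1 (br k) (br k) =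
    (Lie k).comp (m := 2) (n := 2) (r := 3) rfl 0 (br k) (br k) +
      (Lie k).act (Equiv.swap 0 1) ((Lie k).comp (m := 2) (n := 2) (r := 3) rfl 1 (br k) (br k)) :=
  eval_genCls_eq (R := Relators k) Relators.jacobi

/-- The morphism to an operad given by a Lie bracket in it. -/
def liftBr (Q : SymOperad.{u, w} k) (b : Q.obj 2)
    (h1 : Q.act (Equiv.swap 0 1) b = (-1 : k) • b)
    (h2 : Q.comp (m := 2) (n := 2) (r := 3) rfl 1 b b = Q.comp (m := 2) (n := 2) (r := 3) rfl 0 b b +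
      Q.act (Equiv.swap 0 1) (Q.comp (m := 2) (n := 2) (r := 3) rfl 1 b b)) : Hom (Lie k) Q :=
  OpTerm.lift Q (fun _ x => match x with | Gen.bracket => b) (by
    intro n a b h
    cases h with
    | antisymm => exact h1
    | jacobi => exact h2)

theorem hom_ext {Q : SymOperad.{u, w} k} {f g : Hom (Lie k) Q}
    (h : f.app 2 (br k) = g.app 2 (br k)) (n : ℕ) (x : (Lie k).obj n) : f.app n x = g.app n x :=
  OpTerm.hom_ext (R := Relators k) (by rintro n ⟨⟩; exact h) n x

theorem low {n : ℕ} (x : (Lie k).obj n) : (Lie k).Low (Submodule.span k {br k}) n x := by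
  refine BinGen.low (S := {br k}) (Submodule.span k {br k}) Submodule.subset_span ?_ ?_
  · intro x hx
    obtain ⟨c, rfl⟩ := Submodule.mem_span_singleton.mp hx
    rw [map_smul, br_antisymm, smul_smul]
    exact Submodule.smul_mem _ _ (Submodule.mem_span_singleton_self _)
  · refine presented_induction (R := Relators k) (C := fun n x => (Lie k).BinGen {br k} n x)
      ?_ .one .zero (fun x y hx hy => .add x y hx hy) (fun c x hx => .smul c x hx)
      (fun σ x hx => .act σ x hx) (fun h i x y hx hy => .comp h i x y hx hy) x
    rintro n ⟨⟩
    exact .gen _ rfl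

/-- The morphism to the operad of symbols on the plane. -/
def toSymbol : Hom (Lie k) (SymbolOperad.symbolOperad k (k × k)) :=
  liftBr k _ (SymbolOperad.bracket k) (SymbolOperad.bracket_antisymm k) (SymbolOperad.jacobi k)

/-- A presentation does not show that its elements are nonzero; independence is read off in the
operad of symbols, here and in `smul_br_eq_zero`. -/
theorem smul_one_eq_zero (c : k) (h : c • (Lie k).one = 0) : c = 0 := by
  have h1 := congrArg ((toSymbol k).app 1) h
  rw [map_smul, map_zero, (toSymbol k).app_one] at h1
  have h2 : c * 1 = 0 := congrFun h1 0
  rwa [mul_one] at h2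

theorem smul_br_eq_zero (c : k) (h : c • br k = 0) : c = 0 := by
  have h1 := congrArg ((toSymbol k).app 2) h
  rw [map_smul, map_zero] at h1
  refine (SymbolOperad.smul_bracket_eq_zero k 0 c ?_).2
  rw [zero_smul, zero_add]
  exact h1

theorem end_ext {Φ Ψ : (Lie k).EndHom} (h : Φ.app 2 (br k) = Ψ.app 2 (br k)) : Φ = Ψ :=
  EndHom.eq_of_compHom_eq (π := Hom.id _) (fun _ x => ⟨x, rfl⟩)
    (LieOperad.hom_ext (f := Φ.compHom (Hom.id _)) (g := Ψ.compHom (Hom.id _)) k h)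

/-- The endomorphism multiplying the bracket by `c`. -/
def brScale (c : k) : (Lie k).EndHom :=
  (liftBr k (Lie k) (c • br k)
    (by rw [map_smul, br_antisymm, smul_smul, smul_smul, mul_comm])
    -- Every term of the Jacobi identity is quadratic in the bracket, so c² factors out. Only the
    -- left side is rewritten, because its expression occurs again on the right.
    (by
      simp only [map_smul, LinearMap.smul_apply]
      conv_lhs => rw [br_jacobi]
      simp only [smul_add])).toEnd

theorem brScale_br (c : k) : (brScale k c).app 2 (br k) = c • br k := rfl

/-- Rescaling of the bracket, as a homomorphism of monoids. -/
def brScaleHom : k →* (Lie k).EndHom where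
  toFun := brScale k
  map_one' := end_ext k (by rw [brScale_br, one_smul]; rfl)
  map_mul' c d := end_ext k (by
    rw [EndHom.mul_app, brScale_br, brScale_br, map_smul, brScale_br, smul_smul, mul_comm])

/-- The endomorphisms of the Lie operad are the rescalings of the bracket. -/
noncomputable def endEquiv : k ≃* (Lie k).EndHom :=
  MulEquiv.ofBijective (brScaleHom k)
    ⟨by
      intro c d h
      have e := congrArg (fun Φ : (Lie k).EndHom => Φ.app 2 (br k)) h
      rw [← sub_eq_zero]
      apply smul_br_eq_zero
      rw [sub_smul, sub_eq_zero]
      exact e, by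
      intro Φ
      obtain ⟨c, hc⟩ := Submodule.mem_span_singleton.mp
        (show Φ.app 2 (br k) ∈ Submodule.span k {br k} from low k (Φ.app 2 (br k)))
      exact ⟨c, end_ext k hc⟩⟩

theorem endEquiv_unit (c : kˣ) : endEquiv k c = ((Lie k).scale c).1 :=
  end_ext k ((scale_app_two _ c (br k)).symm)

theorem range_scale_eq_IAut : (Lie k).scale.range = (Lie k).IAut :=
  range_scale _ (fun x => low k x) (smul_one_eq_zero k)

/-- Automorphisms are the units of the endomorphism monoid, that is of `k`, and a unit of `k`
corresponds to a scaling. -/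
theorem IAut_eq_top : (Lie k).IAut = ⊤ := by
  rw [← range_scale_eq_IAut, eq_top_iff]
  rintro Φ -
  refine ⟨(Units.mapEquiv (endEquiv k)).symm Φ, ?_⟩
  apply Units.ext
  rw [← endEquiv_unit]
  exact (endEquiv k).apply_symm_apply Φ.1

theorem endo_auto :
    (Function.Injective (Lie k).scale ∧ (Lie k).scale.range = (Lie k).IAut) ∧
      (Lie k).IAut = ⊤ ∧ Subsingleton (Lie k).OAut ∧
      (∃ e : (Lie k).EndHom ≃* k, ∀ c : kˣ, e ((Lie k).scale c).1 = c) := by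
  refine ⟨⟨scale_injective _ (br k) (smul_br_eq_zero k), range_scale_eq_IAut k⟩, IAut_eq_top k, ?_,
    (endEquiv k).symm, fun c => ?_⟩
  · unfold OAut
    rw [IAut_eq_top]
    exact QuotientGroup.subsingleton_quotient_top
  · rw [← endEquiv_unit, MulEquiv.symm_apply_apply]

end LieOperad

/-! ### Poisson structures and the low arities of the Poisson operad -/

namespace PoisOperad

open SymOperad OpTerm

variable (k : Type u) [CommRing k]

/-- The commutative product. -/
def mul : (Pois k).obj 2 := genCls (Relators k) Gen.mul

/-- The Poisson bracket. -/
def br : (Pois k).obj 2 := genCls (Relators k) Gen.bracket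

/-- A unit, a product and a bracket that make algebras over `Q` into unital Poisson algebras. -/
structure IsPoisson {k : Type u} [CommRing k] (Q : SymOperad.{u, w} k) (e : Q.obj 0)
    (m b : Q.obj 2) : Prop where
  mul_unit : ∀ i, Q.comp (m := 2) (n := 0) (r := 1) rfl i m e = Q.one
  bracket_unit : ∀ i, Q.comp (m := 2) (n := 0) (r := 1) rfl i b e = 0
  mul_comm : Q.act (Equiv.swap 0 1) m = m
  antisymm : Q.act (Equiv.swap 0 1) b = (-1 : k) • b
  mul_assoc : Q.comp (m := 2) (n := 2) (r := 3) rfl 0 m m =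
    Q.comp (m := 2) (n := 2) (r := 3) rfl 1 m m
  leibniz : Q.comp (m := 2) (n := 2) (r := 3) rfl 0 b m =
    Q.comp (m := 2) (n := 2) (r := 3) rfl 1 m b +
      Q.act (Equiv.swap 0 1) (Q.comp (m := 2) (n := 2) (r := 3) rfl 1 m b)
  jacobi : Q.comp (m := 2) (n := 2) (r := 3) rfl 1 b b =
    Q.comp (m := 2) (n := 2) (r := 3) rfl 0 b b +
      Q.act (Equiv.swap 0 1) (Q.comp (m := 2) (n := 2) (r := 3) rfl 1 b b)

theorem isPoisson : IsPoisson (Pois k) (unit k) (mul k) (br k) where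
  mul_unit i := by
    fin_cases i
    · exact eval_genCls_eq (R := Relators k) Relators.unit_mul
    · exact eval_genCls_eq (R := Relators k) Relators.mul_unit
  bracket_unit i := by
    fin_cases i
    · exact eval_genCls_eq (R := Relators k) Relators.unit_bracket
    · exact eval_genCls_eq (R := Relators k) Relators.bracket_unit
  mul_comm := eval_genCls_eq (R := Relators k) Relators.mul_comm
  antisymm := eval_genCls_eq (R := Relators k) Relators.antisymm
  mul_assoc := eval_genCls_eq (R := Relators k) Relators.mul_assoc
  leibniz := eval_genCls_eq (R := Relators k) Relators.leibniz
  jacobi := eval_genCls_eq (R := Relators k) Relators.jacobi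

theorem isPoisson_symbol : IsPoisson (SymbolOperad.symbolOperad k (k × k)) (SymbolOperad.unit k)
    (SymbolOperad.mul k) (SymbolOperad.bracket k) where
  mul_unit _ := funext fun _ => _root_.mul_one (1 : k)
  bracket_unit i := SymbolOperad.bracket_unit k i
  mul_comm := rfl
  antisymm := SymbolOperad.bracket_antisymm k
  mul_assoc := rfl
  leibniz := SymbolOperad.leibniz k
  jacobi := SymbolOperad.jacobi k

/-- Applied to an endomorphism composed with the projection, this supplies all the equations that
the coefficients of the endomorphism must satisfy. -/
theorem IsPoisson.map {k : Type u} [CommRing k] {P : SymOperad.{u, v} k} {Q : SymOperad.{u, w} k}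
    (π : Hom P Q) {e : P.obj 0} {m b : P.obj 2} (h : IsPoisson P e m b) :
    IsPoisson Q (π.app 0 e) (π.app 2 m) (π.app 2 b) where
  mul_unit i := by rw [← π.app_comp, h.mul_unit, π.app_one]
  bracket_unit i := by rw [← π.app_comp, h.bracket_unit, map_zero]
  mul_comm := by rw [← π.app_act, h.mul_comm]
  antisymm := by rw [← π.app_act, h.antisymm, map_smul]
  mul_assoc := by rw [← π.app_comp, h.mul_assoc, π.app_comp]
  leibniz := by
    simp only [← π.app_comp, ← π.app_act, ← map_add]
    rw [h.leibniz]
  jacobi := by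
    simp only [← π.app_comp, ← π.app_act, ← map_add]
    exact congrArg _ h.jacobi

/-- All relations are homogeneous in the product and in the bracket separately, except that the unit
law ties the scale of the unit to the inverse of that of the product. Hence x must be a unit, while
c is free. -/
theorem IsPoisson.smul {k : Type u} [CommRing k] {Q : SymOperad.{u, w} k} {e : Q.obj 0}
    {m b : Q.obj 2} (h : IsPoisson Q e m b) (c : k) (x : kˣ) :
    IsPoisson Q (((x⁻¹ : kˣ) : k) • e) ((x : k) • m) (c • b) where
  mul_unit i := by simp [smul_smul, h.mul_unit]
  bracket_unit i := by simp [h.bracket_unit]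
  mul_comm := by rw [map_smul, h.mul_comm]
  antisymm := by rw [map_smul, h.antisymm, smul_comm]
  mul_assoc := by simp only [map_smul, LinearMap.smul_apply, h.mul_assoc]
  leibniz := by
    simp only [map_smul, LinearMap.smul_apply, h.leibniz, smul_add, smul_comm c (x : k)]
  jacobi := by
    simp only [map_smul, LinearMap.smul_apply]
    conv_lhs => rw [h.jacobi]
    simp only [smul_add]

/-- The morphism to an operad given by a Poisson structure in it. -/
def liftPois {Q : SymOperad.{u, w} k} {e : Q.obj 0} {m b : Q.obj 2} (hQ : IsPoisson Q e m b) :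
    Hom (Pois k) Q :=
  OpTerm.lift Q
    (fun _ x => match x with
      | Gen.unit => e
      | Gen.mul => m
      | Gen.bracket => b)
    (by
      intro n a b h
      cases h with
      | unit_mul => exact hQ.mul_unit 0
      | mul_unit => exact hQ.mul_unit 1
      | unit_bracket => exact hQ.bracket_unit 0
      | bracket_unit => exact hQ.bracket_unit 1
      | mul_comm => exact hQ.mul_comm
      | antisymm => exact hQ.antisymm
      | mul_assoc => exact hQ.mul_assoc
      | leibniz => exact hQ.leibniz
      | jacobi => exact hQ.jacobi)

theorem hom_ext {Q : SymOperad.{u, w} k} {f g : Hom (Pois k) Q}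
    (h0 : f.app 0 (unit k) = g.app 0 (unit k)) (h1 : f.app 2 (mul k) = g.app 2 (mul k))
    (h2 : f.app 2 (br k) = g.app 2 (br k)) (n : ℕ) (x : (Pois k).obj n) : f.app n x = g.app n x :=
  OpTerm.hom_ext (R := Relators k) (by rintro n ⟨⟩ <;> assumption) n x

/-- The binary operations generating `Pois` under the unit. -/
abbrev binOps : Submodule k ((Pois k).obj 2) := Submodule.span k {mul k, br k}

theorem swap_mem_binOps (x : (Pois k).obj 2) (hx : x ∈ binOps k) :
    (Pois k).act (Equiv.swap 0 1) x ∈ binOps k := by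
  obtain ⟨a, b, rfl⟩ := Submodule.mem_span_pair.mp hx
  rw [map_add, map_smul, map_smul, (isPoisson k).mul_comm, (isPoisson k).antisymm, smul_smul]
  exact Submodule.mem_span_pair.mpr ⟨_, _, rfl⟩

/-- In positive arity, `Pois` is generated by the product and the bracket. -/
theorem binGen {n : ℕ} (x : (Pois k).obj n) (hn : 0 < n) : (Pois k).BinGen {mul k, br k} n x := by
  refine presented_induction (R := Relators k)
    (C := fun n x => 0 < n → (Pois k).BinGen {mul k, br k} n x)
    ?_ (fun _ => .one) (fun _ _ => .zero _) (fun x y hx hy hn => .add x y (hx hn) (hy hn))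
    (fun c x hx hn => .smul c x (hx hn)) (fun σ x hx hn => .act σ x (hx hn)) ?_ x hn
  · rintro n ⟨⟩ hn
    · omega
    · exact .gen _ (Or.inl rfl)
    · exact .gen _ (Or.inr rfl)
  · intro m n r h i x y hx hy hr
    have hm : 0 < m := by have := i.2; omega
    -- The generator of arity 0 enters only by being plugged in, and `BinGen.comp_unit` eliminates
    -- it as long as the arity stays positive.
    rcases Nat.eq_zero_or_pos n with rfl | hn
    · obtain ⟨c, rfl⟩ := unit_span k y
      refine (congrArg ((Pois k).BinGen {mul k, br k} r)
        (map_smul ((Pois k).comp h i x) c (unit k))).mpr (.smul _ _ ?_)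
      refine BinGen.comp_unit (M := binOps k) Submodule.subset_span (swap_mem_binOps k) (unit k) ?_
        (hx hm) h hr i
      rintro x (rfl | rfl) i
      · exact ⟨1, by rw [(isPoisson k).mul_unit, one_smul]⟩
      · exact ⟨0, by rw [(isPoisson k).bracket_unit, zero_smul]⟩
    · exact .comp h i x y (hx hm) (hy hn)

theorem low {n : ℕ} (x : (Pois k).obj n) (hn : 0 < n) : (Pois k).Low (binOps k) n x :=
  (binGen k x hn).low _ Submodule.subset_span (swap_mem_binOps k)

theorem exists_smul_one (x : (Pois k).obj 1) : ∃ c : k, x = c • (Pois k).one :=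
  low k x one_pos

theorem exists_smul_mul_add (x : (Pois k).obj 2) : ∃ a b : k, x = a • mul k + b • br k := by
  obtain ⟨a, b, h⟩ := Submodule.mem_span_pair.mp (show x ∈ binOps k from low k x two_pos)
  exact ⟨a, b, h.symm⟩

/-- The morphism to the operad of symbols on the plane. -/
def toSymbol : Hom (Pois k) (SymbolOperad.symbolOperad k (k × k)) := liftPois k (isPoisson_symbol k)

theorem smul_one_eq_zero (c : k) (h : c • (Pois k).one = 0) : c = 0 := by
  have h1 := congrArg ((toSymbol k).app 1) h
  rw [map_smul, map_zero, (toSymbol k).app_one] at h1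
  have h2 : c * 1 = 0 := congrFun h1 0
  rwa [mul_one] at h2

theorem smul_add_smul_eq_zero (c d : k) (h : c • mul k + d • br k = 0) : c = 0 ∧ d = 0 := by
  have h1 := congrArg ((toSymbol k).app 2) h
  rw [map_add, map_smul, map_smul, map_zero] at h1
  exact SymbolOperad.smul_bracket_eq_zero k c d h1

theorem sq_eq_zero_of_assoc (x y : k)
    (h : (Pois k).comp (m := 2) (n := 2) (r := 3) rfl 0 (x • mul k + y • br k)
        (x • mul k + y • br k) =
      (Pois k).comp (m := 2) (n := 2) (r := 3) rfl 1 (x • mul k + y • br k)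
        (x • mul k + y • br k)) : y * y = 0 := by
  have h1 := congrArg ((toSymbol k).app 3) h
  rw [(toSymbol k).app_comp, (toSymbol k).app_comp, map_add, map_smul, map_smul] at h1
  exact SymbolOperad.sq_eq_zero_of_assoc k x y h1

end PoisOperad

/-- The quotient by the kernel of a surjective homomorphism. -/
theorem nonempty_quotient_mulEquiv {G H : Type*} [Group G] [Group H] (N : Subgroup G) [N.Normal]
    (f : G →* H) (hf : Function.Surjective f) (hN : f.ker = N) : Nonempty (G ⧸ N ≃* H) :=
  ⟨(QuotientGroup.quotientMulEquivOfEq hN.symm).trans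
    (QuotientGroup.quotientKerEquivOfSurjective f hf)⟩

/-! ### Classification of the endomorphisms of the Poisson operad and its truncations -/

namespace PoisOperad

open SymOperad OpTerm

variable {k : Type u} [CommRing k]

/-- Poisson structures among the linear combinations of the operations of a Poisson structure. -/
theorem IsPoisson.coeff_eq {Q : SymOperad.{u, w} k} {e : Q.obj 0} {m b : Q.obj 2}
    (hQ : IsPoisson Q e m b) (h1 : ∀ c : k, c • Q.one = 0 → c = 0)
    (h2 : ∀ c d : k, c • m + d • b = 0 → c = 0 ∧ d = 0) {a x y z t : k}
    (h : IsPoisson Q (a • e) (x • m + y • b) (z • m + t • b)) :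
    a * x = 1 ∧ 2 * y = 0 ∧ z = 0 := by
  have hax : a * x = 1 := by
    have e1 := h.mul_unit 0
    simp only [map_add, map_smul, LinearMap.add_apply, LinearMap.smul_apply, hQ.mul_unit,
      hQ.bracket_unit, smul_zero, add_zero, smul_smul] at e1
    rw [← sub_eq_zero]
    apply h1
    rw [sub_smul, e1, one_smul, sub_self]
  have haz : a * z = 0 := by
    have e1 := h.bracket_unit 0
    simp only [map_add, map_smul, LinearMap.add_apply, LinearMap.smul_apply, hQ.mul_unit,
      hQ.bracket_unit, smul_zero, add_zero, smul_smul] at e1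
    exact h1 _ e1
  -- The swap fixes the product and negates the bracket, so commutativity of x m + y b compares y
  -- with -y.
  have hy : 2 * y = 0 := by
    have e1 := h.mul_comm
    rw [map_add, map_smul, map_smul, hQ.mul_comm, hQ.antisymm, smul_smul, add_right_inj,
      ← sub_eq_zero, ← sub_smul] at e1
    have e2 := (h2 0 _ (by rw [e1, zero_smul, add_zero])).2
    linear_combination -e2
  -- Since x is inverse to a, a z = 0 gives z = 0.
  exact ⟨hax, hy, by linear_combination x * haz - z * hax⟩

/-- Endomorphisms and automorphisms of `Pois` and of its quotients that agree with it in low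
arities. -/
theorem endo_auto_of_hom {Q : SymOperad.{u, w} k} (π : Hom (Pois k) Q)
    (hsurj : ∀ n, Function.Surjective (π.app n))
    (hinj : ∀ n, n < 3 → Function.Injective (π.app n))
    (h3 : (Function.Injective (π.app 3) ∧ ∀ e : k, 2 * e = 0 → e * e = 0 → e = 0) ∨
      ∀ e : k, 2 * e = 0 → e = 0)
    (hlift : ∀ (Φ : (Pois k).EndHom) (c : kˣ), Φ.app 0 (unit k) = (c : k) • unit k →
      ∃ Ψ : Q.EndHom, ∀ n θ, Ψ.app n (π.app n θ) = π.app n (Φ.app n θ)) :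
    (Function.Injective Q.scale ∧ Q.scale.range = Q.IAut) ∧
      (∃ e : Q.AutGroup ≃* kˣ × kˣ, ∀ c : kˣ, e (Q.scale c) = (c, c)) ∧
      Nonempty (Q.OAut ≃* kˣ) ∧
      (∃ e : Q.EndHom ≃* k × kˣ, ∀ c : kˣ, e (Q.scale c).1 = ((c : k), c)) := by
  have hQ := (isPoisson k).map π
  have free1 : ∀ c : k, c • Q.one = 0 → c = 0 := by
    intro c hc
    apply smul_one_eq_zero k c
    apply hinj 1 (by omega)
    rw [map_smul, π.app_one, hc, map_zero]
  have free2 : ∀ c d : k, c • π.app 2 (mul k) + d • π.app 2 (br k) = 0 → c = 0 ∧ d = 0 := by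
    intro c d h
    apply smul_add_smul_eq_zero k c d
    apply hinj 2 (by omega)
    rw [map_add, map_smul, map_smul, h, map_zero]
  have span1 : ∀ x : Q.obj 1, ∃ c : k, x = c • Q.one := by
    intro x
    obtain ⟨x, rfl⟩ := hsurj 1 x
    obtain ⟨c, rfl⟩ := exists_smul_one k x
    exact ⟨c, by rw [map_smul, π.app_one]⟩
  have span2 : ∀ x : Q.obj 2, ∃ a b : k, x = a • π.app 2 (mul k) + b • π.app 2 (br k) := by
    intro x
    obtain ⟨x, rfl⟩ := hsurj 2 x
    obtain ⟨a, b, rfl⟩ := exists_smul_mul_add k x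
    exact ⟨a, b, by rw [map_add, map_smul, map_smul]⟩
  have ext : ∀ {Φ Ψ : Q.EndHom}, Φ.app 0 (π.app 0 (unit k)) = Ψ.app 0 (π.app 0 (unit k)) →
      Φ.app 2 (π.app 2 (mul k)) = Ψ.app 2 (π.app 2 (mul k)) →
      Φ.app 2 (π.app 2 (br k)) = Ψ.app 2 (π.app 2 (br k)) → Φ = Ψ := by
    intro Φ Ψ h0 h1 h2
    exact EndHom.eq_of_compHom_eq hsurj
      (PoisOperad.hom_ext k (f := Φ.compHom π) (g := Ψ.compHom π) h0 h1 h2)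
  -- The pair consists of the factor of the bracket and the factor of the product. The unit is
  -- multiplied by the inverse of the latter, which is a unit of `k`, so the endomorphism descends
  -- to `Q`.
  have hex : ∀ p : k × kˣ, ∃ Ψ : Q.EndHom,
      Ψ.app 0 (π.app 0 (unit k)) = ((p.2⁻¹ : kˣ) : k) • π.app 0 (unit k) ∧
      Ψ.app 2 (π.app 2 (mul k)) = (p.2 : k) • π.app 2 (mul k) ∧
      Ψ.app 2 (π.app 2 (br k)) = p.1 • π.app 2 (br k) := by
    intro p
    obtain ⟨Ψ, hΨ⟩ := hlift (liftPois k ((isPoisson k).smul p.1 p.2)).toEnd p.2⁻¹ rfl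
    refine ⟨Ψ, ?_, ?_, ?_⟩
    · rw [hΨ, ← map_smul]
      rfl
    · rw [hΨ, ← map_smul]
      rfl
    · rw [hΨ, ← map_smul]
      rfl
  choose F hF0 hF1 hF2 using hex
  let f : k × kˣ →* Q.EndHom :=
    { toFun := F
      map_one' := by
        apply ext
        · rw [hF0]
          simp [EndHom.one_app]
        · rw [hF1]
          simp [EndHom.one_app]
        · rw [hF2]
          simp [EndHom.one_app]
      map_mul' := by
        intro p q
        apply ext
        · rw [hF0, EndHom.mul_app, hF0, map_smul, hF0, smul_smul, Prod.snd_mul, mul_inv,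
            Units.val_mul, mul_comm]
        · rw [hF1, EndHom.mul_app, hF1, map_smul, hF1, smul_smul, Prod.snd_mul, Units.val_mul,
            mul_comm]
        · rw [hF2, EndHom.mul_app, hF2, map_smul, hF2, smul_smul, Prod.fst_mul, mul_comm] }
  have finj : Function.Injective f := by
    intro p q h
    have e1 : (p.2 : k) • π.app 2 (mul k) = (q.2 : k) • π.app 2 (mul k) := by
      rw [← hF1, ← hF1]
      exact congrArg (fun Φ : Q.EndHom => Φ.app 2 (π.app 2 (mul k))) h
    have e2 : p.1 • π.app 2 (br k) = q.1 • π.app 2 (br k) := by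
      rw [← hF2, ← hF2]
      exact congrArg (fun Φ : Q.EndHom => Φ.app 2 (π.app 2 (br k))) h
    have e3 := free2 ((p.2 : k) - q.2) (p.1 - q.1) (by rw [sub_smul, sub_smul, e1, e2]; simp)
    exact Prod.ext (sub_eq_zero.mp e3.2) (Units.ext (sub_eq_zero.mp e3.1))
  have fsurj : Function.Surjective f := by
    intro Φ
    obtain ⟨a, ha⟩ : ∃ a : k, Φ.app 0 (π.app 0 (unit k)) = a • π.app 0 (unit k) := by
      obtain ⟨x, hx⟩ := hsurj 0 (Φ.app 0 (π.app 0 (unit k)))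
      obtain ⟨a, rfl⟩ := unit_span k x
      exact ⟨a, by rw [← hx, map_smul]⟩
    obtain ⟨x, y, hxy⟩ := span2 (Φ.app 2 (π.app 2 (mul k)))
    obtain ⟨z, t, hzt⟩ := span2 (Φ.app 2 (π.app 2 (br k)))
    have hΦ : IsPoisson Q _ _ _ := (isPoisson k).map (Φ.compHom π)
    change IsPoisson Q (Φ.app 0 (π.app 0 (unit k))) (Φ.app 2 (π.app 2 (mul k)))
      (Φ.app 2 (π.app 2 (br k))) at hΦ
    rw [ha, hxy, hzt] at hΦ
    obtain ⟨hax, hy, rfl⟩ := hQ.coeff_eq free1 free2 hΦ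
    obtain rfl : y = 0 := by
      -- If arity 3 injects, associativity of the image of the product adds y² = 0 to 2 y = 0;
      -- otherwise 2 y = 0 is enough by hypothesis.
      rcases h3 with ⟨h3, hk⟩ | hk
      · refine hk y hy (sq_eq_zero_of_assoc k x y (h3 ?_))
        rw [π.app_comp, π.app_comp, map_add, map_smul, map_smul]
        exact hΦ.mul_assoc
      · exact hk y hy
    refine ⟨(t, ⟨x, a, by rw [mul_comm, hax], hax⟩), ext ?_ ?_ ?_⟩
    · exact (hF0 _).trans ha.symm
    · refine (hF1 _).trans ?_
      rw [hxy, zero_smul, add_zero]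
    · refine (hF2 _).trans ?_
      rw [hzt, zero_smul, zero_add]
  let e : Q.EndHom ≃* k × kˣ := (MulEquiv.ofBijective f ⟨finj, fsurj⟩).symm
  have he : ∀ c : kˣ, e (Q.scale c).1 = ((c : k), c) := by
    intro c
    refine (MulEquiv.symm_apply_eq _).mpr (ext ?_ ?_ ?_)
    · exact (scale_app_zero _ c _).trans (hF0 ((c : k), c)).symm
    · exact (scale_app_two _ c _).trans (hF1 ((c : k), c)).symm
    · exact (scale_app_two _ c _).trans (hF2 ((c : k), c)).symm
  -- The units of k × kˣ are pairs of units; `toUnits` identifies the units of the group kˣ with kˣ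
  -- itself.
  let e' : Q.AutGroup ≃* kˣ × kˣ :=
    ((Units.mapEquiv e).trans MulEquiv.prodUnits).trans
      (MulEquiv.prodCongr (MulEquiv.refl _) toUnits.symm)
  have he' : ∀ c : kˣ, e' (Q.scale c) = (c, c) := by
    intro c
    apply Prod.ext
    · exact Units.ext (congrArg Prod.fst (he c))
    · exact Units.ext (congrArg (fun p : k × kˣ => (p.2 : k)) (he c))
  have hI : Q.scale.range = Q.IAut := range_scale Q span1 free1
  refine ⟨⟨scale_injective Q (π.app 2 (mul k)) ?_, hI⟩, ⟨e', he'⟩, ?_, ⟨e, he⟩⟩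
  · intro c hc
    exact (free2 c 0 (by rw [hc, zero_smul, add_zero])).1
  -- The ratio of the bracket factor to the product factor is trivial exactly on the diagonal, which
  -- is the group of scalings, so it is the invariant of an outer class.
  · let d : Q.AutGroup →* kˣ :=
      ((MonoidHom.fst kˣ kˣ) / (MonoidHom.snd kˣ kˣ)).comp e'.toMonoidHom
    have hd : ∀ Φ, d Φ = (e' Φ).1 / (e' Φ).2 := fun _ => rfl
    refine nonempty_quotient_mulEquiv Q.IAut d ?_ ?_
    · intro c
      exact ⟨e'.symm (c, 1), by rw [hd, MulEquiv.apply_symm_apply, div_one]⟩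
    · rw [← hI]
      ext Φ
      rw [MonoidHom.mem_ker, hd, div_eq_one]
      constructor
      · intro h
        exact ⟨(e' Φ).1, e'.injective ((he' _).trans (Prod.ext rfl h))⟩
      · rintro ⟨c, rfl⟩
        rw [he']

theorem endo_auto (hk : ∀ e : k, 2 * e = 0 → e * e = 0 → e = 0) (P : SymOperad.{u, u} k)
    (hP : P = Pois k ∨ ∃ K : ℕ, 3 ≤ K ∧ (K = 3 → ∀ e : k, 2 * e = 0 → e = 0) ∧
      P = PoisTrunc k K) :
    (Function.Injective P.scale ∧ P.scale.range = P.IAut) ∧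
      (∃ e : P.AutGroup ≃* kˣ × kˣ, ∀ c : kˣ, e (P.scale c) = (c, c)) ∧
      Nonempty (P.OAut ≃* kˣ) ∧
      (∃ e : P.EndHom ≃* k × kˣ, ∀ c : kˣ, e (P.scale c).1 = ((c : k), c)) := by
  rcases hP with rfl | ⟨K, hK, h3, rfl⟩
  · exact endo_auto_of_hom (Hom.id _) (fun _ x => ⟨x, rfl⟩) (fun _ _ _ _ h => h)
      (.inl ⟨fun _ _ h => h, hk⟩) (fun Φ _ _ => ⟨Φ, fun _ _ => rfl⟩)
  · refine endo_auto_of_hom (Q := PoisTrunc k K) (quotMk _ _) (quotMk_surjective _ _)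
      (fun n hn => quotMk_injective _ _ (unit_span k) (by omega)) ?_
      (fun Φ c hc => exists_truncEnd (unit_span k) K Φ c hc)
    rcases hK.eq_or_lt with rfl | hK
    · exact .inr (h3 rfl)
    · exact .inl ⟨quotMk_injective _ _ (unit_span k) hK, hk⟩

end PoisOperad

/-! ### Block permutations of identities and of reversals -/

/-- Multiplicativity makes this permutation idempotent, and the identity is the only idempotent in a
group. -/
theorem permComp_one_one {m n r : ℕ} (h : r + 1 = m + n) (i : Fin m) :
    permComp h 1 i (1 : Equiv.Perm (Fin n)) = 1 := by
  have e := permComp_mul h 1 1 i (1 : Equiv.Perm (Fin n)) 1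
  simp only [mul_one, Equiv.Perm.one_apply] at e
  exact left_eq_mul.mp e

/-- Reversal is compatible with partial composition. -/
theorem permComp_revPerm {m n r : ℕ} (h : r + 1 = m + n) (i : Fin m) :
    permComp h Fin.revPerm i (Fin.revPerm : Equiv.Perm (Fin n)) = Fin.revPerm := by
  ext p
  have hi := i.2
  have hp' := p.2
  rcases ins_cases h i p with ⟨j, hj, hp⟩ | ⟨t, hp⟩
  · have hj' : j.1 ≠ i.1 := fun e => hj (Fin.ext e)
    have hj2 := j.2
    rw [permComp_inl h _ i _ p j hj hp]
    simp only [Fin.revPerm_apply, Fin.val_rev]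
    split_ifs at hp ⊢ <;> omega
  · have ht := t.2
    rw [permComp_inr h _ i _ p t hp]
    simp only [Fin.revPerm_apply, Fin.val_rev]
    omega

/-! ### The associative operad and its truncations -/

namespace AsOperad

open SymOperad

variable (k : Type u) [CommRing k]

/-- The basis of `As n` indexed by permutations. -/
noncomputable def basis {n : ℕ} (σ : Equiv.Perm (Fin n)) : (As k).obj n := Finsupp.single σ (1 : k)

theorem act_basis {n : ℕ} (σ τ : Equiv.Perm (Fin n)) :
    (As k).act σ (basis k τ) = basis k (τ * σ) :=
  Finsupp.mapDomain_single

theorem comp_basis {m n r : ℕ} (h : r + 1 = m + n) (i : Fin m) (σ : Equiv.Perm (Fin m))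
    (τ : Equiv.Perm (Fin n)) :
    (As k).comp h i (basis k σ) (basis k τ) = basis k (permComp h σ i τ) := by
  refine (comp_single k h i σ τ 1 1).trans ?_
  rw [mul_one]
  rfl

theorem one_eq_basis : (As k).one = basis k 1 := rfl

theorem unit_eq_basis : unit k = basis k 1 := rfl

variable {k} in
theorem basis_induction {n : ℕ} {C : (As k).obj n → Prop} (zero : C 0)
    (add : ∀ x y, C x → C y → C (x + y)) (smul : ∀ (c : k) σ, C (c • basis k σ))
    (x : (As k).obj n) : C x := by
  refine Finsupp.induction_linear (motive := C) x zero add fun σ c => ?_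
  have e : c • basis k σ = Finsupp.single σ c := by
    refine (Finsupp.smul_single c σ (1 : k)).trans ?_
    rw [smul_eq_mul, mul_one]
  rw [← e]
  exact smul c σ

/-- The coefficients with respect to the basis. -/
noncomputable def coeff {n : ℕ} (σ : Equiv.Perm (Fin n)) : (As k).obj n →ₗ[k] k := Finsupp.lapply σ

theorem coeff_basis {n : ℕ} (σ τ : Equiv.Perm (Fin n)) :
    coeff k σ (basis k τ) = if τ = σ then 1 else 0 :=
  Finsupp.single_apply

theorem exists_smul_one (x : (As k).obj 1) : ∃ c : k, x = c • (As k).one := by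
  induction x using basis_induction with
  | zero => exact ⟨0, by rw [zero_smul]⟩
  | add x y hx hy =>
    obtain ⟨c, rfl⟩ := hx
    obtain ⟨d, rfl⟩ := hy
    exact ⟨c + d, by rw [add_smul]⟩
  | smul c σ =>
    obtain rfl : σ = 1 := Subsingleton.elim _ _
    exact ⟨c, rfl⟩

theorem exists_smul_add_smul (x : (As k).obj 2) :
    ∃ a b : k, x = a • basis k 1 + b • basis k (Equiv.swap 0 1) := by
  induction x using basis_induction with
  | zero => exact ⟨0, 0, by simp⟩
  | add x y hx hy =>
    obtain ⟨a, b, rfl⟩ := hx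
    obtain ⟨c, d, rfl⟩ := hy
    exact ⟨a + c, b + d, by rw [add_smul, add_smul, add_add_add_comm]⟩
  | smul c σ =>
    have h2 : ∀ σ : Equiv.Perm (Fin 2), σ = 1 ∨ σ = Equiv.swap 0 1 := by decide
    rcases h2 σ with rfl | rfl
    · exact ⟨c, 0, by simp⟩
    · exact ⟨0, c, by simp⟩

theorem smul_one_eq_zero (c : k) (h : c • (As k).one = 0) : c = 0 := by
  have h1 := congrArg (coeff k 1) h
  rw [map_smul, map_zero, one_eq_basis, coeff_basis, if_pos rfl] at h1
  simpa using h1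

theorem smul_add_smul_eq_zero (c d : k)
    (h : c • basis k (1 : Equiv.Perm (Fin 2)) + d • basis k (Equiv.swap 0 1) = 0) :
    c = 0 ∧ d = 0 := by
  have h1 := congrArg (coeff k 1) h
  have h2 := congrArg (coeff k (Equiv.swap 0 1)) h
  have e : (1 : Equiv.Perm (Fin 2)) ≠ Equiv.swap 0 1 := by decide
  simp only [map_add, map_smul, map_zero, coeff_basis, if_neg e, if_neg e.symm, if_true] at h1 h2
  exact ⟨by simpa using h1, by simpa using h2⟩

/-- `As` is generated by the unit and the product. -/
theorem hom_ext {Q : SymOperad.{u, w} k} {f g : Hom (As k) Q}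
    (h0 : f.app 0 (unit k) = g.app 0 (unit k))
    (h2 : f.app 2 (basis k 1) = g.app 2 (basis k 1)) (n : ℕ) (x : (As k).obj n) :
    f.app n x = g.app n x := by
  -- The identity permutation is the iterated product: in arity n + 1 it is the binary product with
  -- the one of arity n in its first input. The symmetric group then reaches every permutation.
  have key : ∀ n : ℕ, f.app n (basis k 1) = g.app n (basis k 1) := by
    intro n
    induction n with
    | zero => exact h0
    | succ n ih =>
      have e := comp_basis k (m := 2) (n := n) (r := n + 1) (by omega) 0 1 1
      rw [permComp_one_one] at e
      rw [← e, f.app_comp, g.app_comp, h2, ih]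
  induction x using basis_induction with
  | zero => rw [map_zero, map_zero]
  | add x y hx hy => rw [map_add, map_add, hx, hy]
  | smul c σ =>
    rw [map_smul, map_smul, ← one_mul σ, ← act_basis, f.app_act, g.app_act, key]

/-- The linear map reversing the order of multiplication. -/
noncomputable def opMap (n : ℕ) : (As k).obj n →ₗ[k] (As k).obj n :=
  Finsupp.lmapDomain k k (fun φ => Fin.revPerm * φ)

theorem opMap_basis {n : ℕ} (σ : Equiv.Perm (Fin n)) :
    opMap k n (basis k σ) = basis k (Fin.revPerm * σ) :=
  Finsupp.mapDomain_single

/-- The endomorphism of `As` passing to opposite algebras. -/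
noncomputable def opEnd : (As k).EndHom where
  app := opMap k
  app_one := by
    rw [one_eq_basis, opMap_basis]
    exact congrArg (basis k) (Subsingleton.elim _ _)
  app_act σ θ := by
    induction θ using basis_induction with
    | zero => simp only [map_zero]
    | add x y hx hy => simp only [map_add, hx, hy]
    | smul c τ => simp only [map_smul, act_basis, opMap_basis, mul_assoc]
  app_comp h i μ ν := by
    induction μ using basis_induction with
    | zero => simp only [map_zero, LinearMap.zero_apply]
    | add x y hx hy => simp only [map_add, LinearMap.add_apply, hx, hy]
    | smul c σ =>
      induction ν using basis_induction with
      | zero => simp only [map_zero]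
      | add x y hx hy => simp only [map_add, hx, hy]
      | smul d τ =>
        simp only [map_smul, LinearMap.smul_apply, comp_basis, opMap_basis]
        -- Left multiplication by reversals factors out of the block permutation, and the block
        -- permutation of two reversals is a reversal.
        rw [permComp_mul, permComp_revPerm]

theorem opEnd_unit : (opEnd k).app 0 (unit k) = unit k :=
  (opMap_basis k 1).trans (congrArg (basis k) (Subsingleton.elim _ _))

theorem opEnd_mul :
    (opEnd k).app 2 (basis k 1) = basis k (Equiv.swap 0 1) :=
  (opMap_basis k 1).trans (congrArg (basis k) (by decide))

theorem opEnd_mul_op :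
    (opEnd k).app 2 (basis k (Equiv.swap 0 1)) = basis k 1 :=
  (opMap_basis k _).trans (congrArg (basis k) (by decide))

/-- The only associative combinations of the product and its opposite are the multiples of
either. -/
theorem mul_eq_zero_of_assoc (a b : k)
    (h : (As k).comp (m := 2) (n := 2) (r := 3) rfl 0 (a • basis k 1 + b • basis k (Equiv.swap 0 1))
        (a • basis k 1 + b • basis k (Equiv.swap 0 1)) =
      (As k).comp (m := 2) (n := 2) (r := 3) rfl 1 (a • basis k 1 + b • basis k (Equiv.swap 0 1))
        (a • basis k 1 + b • basis k (Equiv.swap 0 1))) : a * b = 0 := by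
  -- Compare the coefficients of the monomial x₁x₀x₂. On the left it arises once, as (x₁x₀)x₂ with
  -- the inner product reversed, with coefficient a b. On the right x₀ is never in the middle, so it
  -- does not occur.
  have h1 := congrArg (coeff k (Equiv.swap 0 1)) h
  have d1 : permComp (m := 2) (n := 2) (r := 3) rfl 1 0 1 ≠ Equiv.swap 0 1 := by
    decide
  have d2 : permComp (m := 2) (n := 2) (r := 3) rfl 1 0 (Equiv.swap 0 1) = Equiv.swap 0 1 := by
    decide
  have d3 : permComp (m := 2) (n := 2) (r := 3) rfl (Equiv.swap 0 1) 0 1 ≠ Equiv.swap 0 1 := by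
    decide
  have d4 : permComp (m := 2) (n := 2) (r := 3) rfl (Equiv.swap 0 1) 0 (Equiv.swap 0 1) ≠ Equiv.swap 0 1 := by
    decide
  have d5 : permComp (m := 2) (n := 2) (r := 3) rfl 1 1 1 ≠ Equiv.swap 0 1 := by
    decide
  have d6 : permComp (m := 2) (n := 2) (r := 3) rfl 1 1 (Equiv.swap 0 1) ≠ Equiv.swap 0 1 := by
    decide
  have d7 : permComp (m := 2) (n := 2) (r := 3) rfl (Equiv.swap 0 1) 1 1 ≠ Equiv.swap 0 1 := by
    decide
  have d8 : permComp (m := 2) (n := 2) (r := 3) rfl (Equiv.swap 0 1) 1 (Equiv.swap 0 1) ≠ Equiv.swap 0 1 := by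
    decide
  simp only [map_add, map_smul, LinearMap.add_apply, LinearMap.smul_apply, comp_basis, coeff_basis,
    if_neg d1, if_pos d2, if_neg d3, if_neg d4, if_neg d5, if_neg d6, if_neg d7, if_neg d8,
    smul_eq_mul, mul_zero, mul_one, add_zero, zero_add] at h1
  linear_combination h1

variable {k}

/-- Endomorphisms and automorphisms of `As` and of its quotients that agree with it in low
arities. -/
theorem endo_auto_of_hom [Nontrivial k] (hk : ∀ e : k, e * e = e → e = 0 ∨ e = 1)
    {Q : SymOperad.{u, w} k} (π : Hom (As k) Q) (hsurj : ∀ n, Function.Surjective (π.app n))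
    (hinj : ∀ n, n < 4 → Function.Injective (π.app n))
    (hlift : ∀ (Φ : (As k).EndHom) (c : kˣ), Φ.app 0 (unit k) = (c : k) • unit k →
      ∃ Ψ : Q.EndHom, ∀ n θ, Ψ.app n (π.app n θ) = π.app n (Φ.app n θ)) :
    (Function.Injective Q.scale ∧ Q.scale.range = Q.IAut) ∧
      (∃ e : kˣ ⋊[(1 : Multiplicative (ZMod 2) →* MulAut kˣ)] Multiplicative (ZMod 2) ≃*
          Q.AutGroup, ∀ c : kˣ, e (SemidirectProduct.inl c) = Q.scale c) ∧
      Nonempty (Q.OAut ≃* Multiplicative (ZMod 2)) ∧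
      (∀ Φ : Q.EndHom, IsUnit Φ) := by
  have free1 : ∀ c : k, c • Q.one = 0 → c = 0 := by
    intro c hc
    apply smul_one_eq_zero k c
    apply hinj 1 (by omega)
    rw [map_smul, π.app_one, hc, map_zero]
  have free2 : ∀ c d : k, c • π.app 2 (basis k 1) + d • π.app 2 (basis k (Equiv.swap 0 1)) = 0 →
      c = 0 ∧ d = 0 := by
    intro c d h
    apply smul_add_smul_eq_zero k c d
    apply hinj 2 (by omega)
    rw [map_add, map_smul, map_smul, h, map_zero]
  have span1 : ∀ x : Q.obj 1, ∃ c : k, x = c • Q.one := by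
    intro x
    obtain ⟨x, rfl⟩ := hsurj 1 x
    obtain ⟨c, rfl⟩ := exists_smul_one k x
    exact ⟨c, by rw [map_smul, π.app_one]⟩
  have ext : ∀ {Φ Ψ : Q.EndHom}, Φ.app 0 (π.app 0 (unit k)) = Ψ.app 0 (π.app 0 (unit k)) →
      Φ.app 2 (π.app 2 (basis k 1)) = Ψ.app 2 (π.app 2 (basis k 1)) → Φ = Ψ := by
    intro Φ Ψ h0 h2
    exact EndHom.eq_of_compHom_eq hsurj
      (AsOperad.hom_ext k (f := Φ.compHom π) (g := Ψ.compHom π) h0 h2)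
  -- Passage to opposite algebras fixes the unit, so it descends to `Q`; it generates the factor of
  -- order 2.
  obtain ⟨O, hO⟩ := hlift (opEnd k) 1 (by rw [opEnd_unit, Units.val_one, one_smul])
  have hO0 : O.app 0 (π.app 0 (unit k)) = π.app 0 (unit k) := by rw [hO, opEnd_unit]
  have hO1 : O.app 2 (π.app 2 (basis k 1)) = π.app 2 (basis k (Equiv.swap 0 1)) := by
    rw [hO, opEnd_mul]
  have hO2 : O.app 2 (π.app 2 (basis k (Equiv.swap 0 1))) = π.app 2 (basis k 1) := by
    rw [hO, opEnd_mul_op]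
  have hOO : O * O = 1 := ext (by rw [EndHom.mul_app, hO0, hO0]; rfl)
    (by rw [EndHom.mul_app, hO1, hO2]; rfl)
  let o : Q.AutGroup := ⟨O, O, hOO, hOO⟩
  have hoo : o * o = 1 := Units.ext hOO
  have hcomm : ∀ c, o * Q.scale c = Q.scale c * o := by
    intro c
    apply Units.ext
    apply EndHom.ext_app
    intro n θ
    rw [Units.val_mul, Units.val_mul, EndHom.mul_app, EndHom.mul_app, scale_app, scale_app,
      map_smul]
  -- The heart of the classification. Both alternatives are invertible, so this also shows that
  -- every endomorphism is an automorphism.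
  have hclass : ∀ Φ : Q.EndHom, ∃ c : kˣ, Φ = (Q.scale c).1 ∨ Φ = (Q.scale c * o).1 := by
    intro Φ
    obtain ⟨u, hu⟩ : ∃ u : k, Φ.app 0 (π.app 0 (unit k)) = u • π.app 0 (unit k) := by
      obtain ⟨x, hx⟩ := hsurj 0 (Φ.app 0 (π.app 0 (unit k)))
      obtain ⟨a, rfl⟩ := unit_span k x
      exact ⟨a, by rw [← hx, map_smul]⟩
    obtain ⟨a, b, hab⟩ : ∃ a b : k, Φ.app 2 (π.app 2 (basis k 1)) =
        π.app 2 (a • basis k 1 + b • basis k (Equiv.swap 0 1)) := by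
      obtain ⟨x, hx⟩ := hsurj 2 (Φ.app 2 (π.app 2 (basis k 1)))
      obtain ⟨a, b, rfl⟩ := exists_smul_add_smul k x
      exact ⟨a, b, hx.symm⟩
    have huab : u * (a + b) = 1 := by
      have e1 : ∀ σ : Equiv.Perm (Fin 2),
          (As k).comp (m := 2) (n := 0) (r := 1) rfl 0 (basis k σ) (unit k) = (As k).one := by
        intro σ
        rw [unit_eq_basis, comp_basis, one_eq_basis]
        exact congrArg (basis k) (Subsingleton.elim _ _)
      have e2 : ∀ σ : Equiv.Perm (Fin 2), Q.comp (m := 2) (n := 0) (r := 1) rfl 0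
          (π.app 2 (basis k σ)) (π.app 0 (unit k)) = Q.one := by
        intro σ
        rw [← π.app_comp, e1, π.app_one]
      have e3 := congrArg (Φ.app 1) (e2 1)
      rw [Φ.app_one, Φ.app_comp, hu, hab] at e3
      simp only [map_add, map_smul, LinearMap.add_apply, LinearMap.smul_apply, e2, ← add_smul,
        smul_smul] at e3
      rw [← sub_eq_zero]
      apply free1
      rw [sub_smul, e3, one_smul, sub_self]
    -- The image of an associative product is associative in `Q`, and injectivity in arity 3 carries
    -- this identity back to `As`.
    have hab0 : a * b = 0 := by
      apply mul_eq_zero_of_assoc k a b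
      apply hinj 3 (by omega)
      rw [π.app_comp, π.app_comp, ← hab, ← Φ.app_comp, ← Φ.app_comp, ← π.app_comp, ← π.app_comp,
        comp_basis, comp_basis, permComp_one_one, permComp_one_one]
    -- The two factors u a and u b have sum 1 and product u² a b = 0, so u a is idempotent. The
    -- value 0 kills a and leaves the opposite product; the value 1 kills b.
    rcases hk (u * a) (by linear_combination (u * a) * huab - u * u * hab0) with h | h
    · obtain rfl : a = 0 := by linear_combination a * h - a * huab + u * hab0
      rw [zero_add] at huab
      refine ⟨⟨b, u, by rw [mul_comm, huab], huab⟩, .inr (ext ?_ ?_)⟩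
      · rw [Units.val_mul, EndHom.mul_app, scale_app_zero]
        -- The unit c was built from b with inverse u, so the scaling acts on arity 0 by u.
        change _ = u • O.app 0 _
        rw [hO0, hu]
      · rw [Units.val_mul, EndHom.mul_app, scale_app_two]
        change _ = b • O.app 2 _
        rw [hO1, hab, zero_smul, zero_add, map_smul]
    · obtain rfl : b = 0 := by linear_combination u * hab0 - b * h
      rw [add_zero] at huab
      refine ⟨⟨a, u, by rw [mul_comm, huab], huab⟩, .inl (ext ?_ ?_)⟩
      · rw [scale_app_zero, hu]
        rfl
      · rw [scale_app_two, hab, zero_smul, add_zero, map_smul]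
  have hI : Q.scale.range = Q.IAut := range_scale Q span1 free1
  have hinjs : Function.Injective Q.scale := by
    refine scale_injective Q (π.app 2 (basis k 1)) fun c hc => ?_
    exact (free2 c 0 (by rw [hc, zero_smul, add_zero])).1
  have hZ : ∀ ε : Multiplicative (ZMod 2), ε = 1 ∨ ε = Multiplicative.ofAdd 1 := by decide
  have hZ1 : (Multiplicative.ofAdd 1 : Multiplicative (ZMod 2)) ≠ 1 := by decide
  have hZ2 : (Multiplicative.ofAdd 1 : Multiplicative (ZMod 2)) * Multiplicative.ofAdd 1 = 1 := by
    decide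
  let f₂ : Multiplicative (ZMod 2) →* Q.AutGroup :=
    { toFun := fun ε => if ε = 1 then 1 else o
      map_one' := if_pos rfl
      map_mul' := by
        intro ε δ
        rcases hZ ε with rfl | rfl <;> rcases hZ δ with rfl | rfl <;> simp [hZ1, hZ2, hoo] }
  have hf₂ : f₂ (Multiplicative.ofAdd 1) = o :=
    if_neg (c := (Multiplicative.ofAdd 1 : Multiplicative (ZMod 2)) = 1) (t := (1 : Q.AutGroup)) hZ1
  -- The action is trivial because `O` is linear in each arity and hence commutes with scalings.
  let f : kˣ ⋊[(1 : Multiplicative (ZMod 2) →* MulAut kˣ)] Multiplicative (ZMod 2) →* Q.AutGroup :=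
    SemidirectProduct.lift Q.scale f₂ (by
      intro ε
      ext1 c
      change Q.scale c = f₂ ε * Q.scale c * (f₂ ε)⁻¹
      rcases hZ ε with rfl | rfl
      · simp
      · rw [hf₂, hcomm, mul_inv_cancel_right])
  have hf : ∀ g, f g = Q.scale g.left * f₂ g.right := fun _ => rfl
  have finj : Function.Injective f := by
    rw [injective_iff_map_eq_one]
    rintro ⟨c, ε⟩ h
    rw [hf] at h
    rcases hZ ε with rfl | rfl
    · rw [map_one, mul_one] at h
      have hc : c = 1 := hinjs (h.trans (map_one _).symm)
      rw [hc]
      rfl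
    · exfalso
      rw [hf₂] at h
      have e := congrArg (fun Φ : Q.AutGroup => Φ.1.app 2 (π.app 2 (basis k 1))) h
      dsimp only at e
      rw [Units.val_mul, EndHom.mul_app, scale_app_two] at e
      change (c : k) • O.app 2 _ = π.app 2 (basis k 1) at e
      rw [hO1] at e
      -- A scaling times reversal sends the product to a multiple of its opposite, which is
      -- independent of the product. If it were the identity, then -1 = 0, against nontriviality of
      -- `k`.
      have e1 := (free2 (-1) c (by rw [e, neg_smul, one_smul, neg_add_cancel])).1
      exact one_ne_zero (neg_eq_zero.mp e1)
  have fsurj : Function.Surjective f := by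
    intro Φ
    obtain ⟨c, hc | hc⟩ := hclass Φ.1
    · refine ⟨⟨c, 1⟩, Units.ext ?_⟩
      rw [hf, map_one, mul_one, hc]
    · refine ⟨⟨c, Multiplicative.ofAdd 1⟩, Units.ext ?_⟩
      rw [hf, hf₂, hc]
  let e := MulEquiv.ofBijective f ⟨finj, fsurj⟩
  have he : ∀ c : kˣ, e (SemidirectProduct.inl c) = Q.scale c := fun c =>
    (hf _).trans (by simp)
  refine ⟨⟨hinjs, hI⟩, ⟨e, he⟩, ?_, fun Φ => ?_⟩
  -- The outer class records whether the product is reversed: the kernel of the projection to the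
  -- second factor is the group of scalings.
  · refine nonempty_quotient_mulEquiv Q.IAut (SemidirectProduct.rightHom.comp e.symm.toMonoidHom)
      (SemidirectProduct.rightHom_surjective.comp e.symm.surjective) ?_
    rw [← hI]
    ext Φ
    rw [MonoidHom.mem_ker]
    constructor
    · intro h
      refine ⟨(e.symm Φ).left, ?_⟩
      rw [← he, ← MulEquiv.eq_symm_apply]
      exact SemidirectProduct.ext rfl h.symm
    · rintro ⟨c, rfl⟩
      rw [← he]
      simp
  · obtain ⟨c, rfl | rfl⟩ := hclass Φ
    · exact Units.isUnit _
    · exact Units.isUnit _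

theorem endo_auto [Nontrivial k] (hk : ∀ e : k, e * e = e → e = 0 ∨ e = 1)
    (P : SymOperad.{u, u} k) (hP : P = As k ∨ ∃ K : ℕ, 4 ≤ K ∧ P = AsTrunc k K) :
    (Function.Injective P.scale ∧ P.scale.range = P.IAut) ∧
      (∃ e : kˣ ⋊[(1 : Multiplicative (ZMod 2) →* MulAut kˣ)] Multiplicative (ZMod 2) ≃*
          P.AutGroup, ∀ c : kˣ, e (SemidirectProduct.inl c) = P.scale c) ∧
      Nonempty (P.OAut ≃* Multiplicative (ZMod 2)) ∧
      (∀ Φ : P.EndHom, IsUnit Φ) := by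
  rcases hP with rfl | ⟨K, hK, rfl⟩
  · exact endo_auto_of_hom hk (Hom.id _) (fun _ x => ⟨x, rfl⟩) (fun _ _ _ _ h => h)
      (fun Φ _ _ => ⟨Φ, fun _ _ => rfl⟩)
  · exact endo_auto_of_hom hk (Q := AsTrunc k K) (quotMk _ _) (quotMk_surjective _ _)
      (fun n hn => quotMk_injective _ _ (unit_span k) (by omega))
      (fun Φ c hc => exists_truncEnd (unit_span k) K Φ c hc)

end AsOperad

/-! ### The three classifications together -/

theorem proposition3p3 (k : Type u) [CommRing k] :
    -- `As` and `As / ^K I` for `K ≥ 4`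
    (Nontrivial k → (∀ e : k, e * e = e → e = 0 ∨ e = 1) →
      ∀ P : SymOperad.{u, u} k,
        (P = AsOperad.As k ∨ ∃ K : ℕ, 4 ≤ K ∧ P = AsOperad.AsTrunc k K) →
        (Function.Injective P.scale ∧ P.scale.range = P.IAut) ∧
        (∃ e : kˣ ⋊[(1 : Multiplicative (ZMod 2) →* MulAut kˣ)] Multiplicative (ZMod 2) ≃*
            P.AutGroup, ∀ c : kˣ, e (SemidirectProduct.inl c) = P.scale c) ∧
        Nonempty (P.OAut ≃* Multiplicative (ZMod 2)) ∧
        (∀ Φ : P.EndHom, IsUnit Φ)) ∧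
    -- `Lie`
    ((Function.Injective (LieOperad.Lie k).scale ∧
        (LieOperad.Lie k).scale.range = (LieOperad.Lie k).IAut) ∧
      (LieOperad.Lie k).IAut = ⊤ ∧
      Subsingleton (LieOperad.Lie k).OAut ∧
      (∃ e : (LieOperad.Lie k).EndHom ≃* k, ∀ c : kˣ, e ((LieOperad.Lie k).scale c).1 = c)) ∧
    -- `Pois` and `Pois / ^K I` for `K ≥ 3`
    ((∀ e : k, 2 * e = 0 → e * e = 0 → e = 0) →
      ∀ P : SymOperad.{u, u} k,
        (P = PoisOperad.Pois k ∨
          ∃ K : ℕ, 3 ≤ K ∧ (K = 3 → ∀ e : k, 2 * e = 0 → e = 0) ∧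
            P = PoisOperad.PoisTrunc k K) →
        (Function.Injective P.scale ∧ P.scale.range = P.IAut) ∧
        (∃ e : P.AutGroup ≃* kˣ × kˣ, ∀ c : kˣ, e (P.scale c) = (c, c)) ∧
        Nonempty (P.OAut ≃* kˣ) ∧
        (∃ e : P.EndHom ≃* k × kˣ, ∀ c : kˣ, e (P.scale c).1 = ((c : k), c))) := by
  exact ⟨fun _ hk P hP => AsOperad.endo_auto hk P hP, LieOperad.endo_auto k,
    fun hk P hP => PoisOperad.endo_auto hk P hP⟩
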